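/- Let $t\ge 1$ be an integer and let $\mathcal A$ be a class built, possibly through a (possibly recursive) system of equations $\mathcal T_i=\Phi_i(\mathcal T_1,\mathcal T_2,\dots)$ whose least solution is taken, from one-element neutral classes and the atomic class $\mathcal Z$ by the operators $+$ (multiset union), $\times$, $\mathrm{Seq}$, $\mathrm{MSet}$, $\mathrm{Cyc}$ (non-empty cycles) and the diagonals $\Delta_k$ ($k\ge1$; $\Delta_k(\mathcal B)$ consists of the $k$-fold repetitions $\delta_k b=b\cdots b$, $b\in\mathcal B$). Let $\mathcal A^{[t]}$ be the multiset of objects obtained from the same construction when each atom carries a color in $\{1,\dots,t\}$ (for $\Delta_k$, the $k$ copies carry the same colors); colored objects are identified up to permutation of the components of multisets and circular shifts of cycles, recursively. Let $F_{\mathcal A}(s_1,s_2,\dots)\in[0,\infty]$, for $s_i\ge 0$, be given (least solution for recursive systems) by $F=1$ for a neutral class, $F_{\mathcal Z}=s_1$, $F_{\mathcal A+\mathcal B}=F_{\mathcal A}+F_{\mathcal B}$, $F_{\mathcal A\times\mathcal B}=F_{\mathcal A}F_{\mathcal B}$, $F_{\mathrm{Seq}(\mathcal A)}=\frac1{1-F_{\mathcal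 A}}$, $F_{\Delta_k(\mathcal A)}(s_1,s_2,\dots)=F_{\mathcal A}(s_k,s_{2k},\dots)$, $F_{\mathrm{MSet}(\mathcal A)}=\exp\sum_{k\ge1}\frac1kF_{\Delta_k(\mathcal A)}$, $F_{\mathrm{Cyc}(\mathcal A)}=-\sum_{k\ge1}\frac{\varphi(k)}k\ln(1-F_{\Delta_k(\mathcal A)})$, where $\frac1{1-y}$ and $-\ln(1-y)$ are $\infty$ for $y\ge1$. Put $f_{\mathcal A}(x,t)=F_{\mathcal A}(tx,tx^2,tx^3,\dots)$. The profiled sampler $\Gamma\mathcal A_{(s_1,s_2,\dots)}$ draws an object together with a partition of its atoms (its profile), as follows (all draws are independent; profiles of concatenated objects are united; $\delta_k$ repeats an object or a concatenation $k$ times and joins each part of the profile with its copies; parentheses do not change the profile; all generating functions are evaluated at $(s_1,s_2,\dots)$ unless indicated). * Neutral class, $\mathcal Z$: return the neutral object; return the atom. * $\mathcal A+\mathcal B$: call $\Gamma\mathcal A$ with probability $F_{\mathcal A}/F_{\mathcal A+\mathcal B}$, otherwise $\Gamma\mathcal B$. * $\mathcal A\times\mathcal B$: draw $A$ from $\Gamma\mathcal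 A$ and $B$ from $\Gamma\mathcal B$ and return $(AB)$. * $\Delta_k(\mathcal A)$: return $\delta_kA$, with $A$ drawn from $\Gamma\mathcal A_{(s_k,s_{2k},\dots)}$. * $\mathrm{Seq}(\mathcal A)$: draw $q$ with $P(q)=F_{\mathcal A}^q(1-F_{\mathcal A})$, draw $A_1,\dots,A_q$ from $\Gamma\mathcal A$ and return $(A_1\cdots A_q)$. * $\mathrm{MSet}(\mathcal A)$: draw $K\ge1$ with $P(K\le k)=\prod_{j>k}\exp(-\frac1jF_{\Delta_j(\mathcal A)})$. If $K=1$, draw $q_1$ from the Poisson law of parameter $F_{\mathcal A}$. If $K=k>1$, draw $q_j$ from the Poisson law of parameter $\frac1jF_{\Delta_j(\mathcal A)}$ for $1\le j<k$, and $q_k$ from the Poisson law of parameter $\frac1kF_{\Delta_k(\mathcal A)}$ conditioned to be positive. For each $j\le K$ draw $q_j$ objects from $\Gamma\Delta_j(\mathcal A)$; return $\{\,\cdot\,\}$ around the concatenation of all of them. * $\mathrm{Cyc}(\mathcal A)$: draw $k\ge1$ with $P(k)=-\frac1{F_{\mathrm{Cyc}(\mathcal A)}}\frac{\varphi(k)}k\ln(1-F_{\Delta_k(\mathcal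 A)})$, then $l\ge1$ with $P(l)=-\frac{(F_{\Delta_k(\mathcal A)})^l}{l}\frac1{\ln(1-F_{\Delta_k(\mathcal A)})}$; draw $A_1,\dots,A_l$ from $\Gamma\mathcal A_{(s_k,s_{2k},\dots)}$ and return $[\delta_k(A_1\cdots A_l)]$. * A class name $\mathcal T_i$: run the sampler of $\Phi_i(\mathcal T_1,\mathcal T_2,\dots)$ recursively. **Proposition 4.1.** Let $x\ge0$ be a real number with $0<f_{\mathcal A}(x,t)<\infty$. Substitute $s_i=t\,x^i$, draw a profiled object with $\Gamma\mathcal A_{(s_1,s_2,\dots)}$, color each part of its profile, independently, with a uniform color in $\{1,\dots,t\}$, and give every atom the color of its part. The resulting procedure is a valid Boltzmann sampler for $\mathcal A^{[t]}$: it terminates with probability $1$, and it returns each $t$-colored object $a$ with probability $\dfrac{m(a)\,x^{|a|}}{f_{\mathcal A}(x,t)}$, where $|a|$ is the number of atoms of $a$ and $m(a)$ is the multiplicity of $a$ in $\mathcal A^{[t]}$ (so with probability $x^{|a|}/f_{\mathcal A}(x,t)$ for each member of the multiset). -/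

import Mathlib

open scoped ENNReal NNReal

universe u

namespace ColoredBoltzmann

noncomputable section

/-! ## Colored words and colored combinatorial objects -/

/-- The three types of parentheses: `( )`, `[ ]` and `{ }`. -/
inductive Paren : Type
  | seq
  | cyc
  | mset

/-- The reorderings of the `n` components under which a parenthesised word is unchanged: none for
a sequence, the circular shifts for a cycle, all permutations for a multiset. -/
def Paren.sym (p : Paren) (n : ℕ) : Subgroup (Equiv.Perm (Fin n)) :=
  match p with
  | .seq => ⊥
  | .cyc => Subgroup.zpowers (finRotate n)
  | .mset => ⊤

/-- `B`-colored proto-objects: well-parenthesised words over atoms `□`, together with a map from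
the occurrences of `□` to `B` (the color is written at the occurrence).
`n = 0` in `node` gives the words `()`, `[]`, `{}`. -/
inductive Word (B : Type) : Type
  | atom (b : B) : Word B
  | node (p : Paren) {n : ℕ} (f : Fin n → Word B) : Word B

namespace Word

variable {B C : Type}

/-- Recoloring. -/
def map (c : B → C) : Word B → Word C
  | atom b => atom (c b)
  | node p f => node p fun i => (f i).map c

/-- The number of atoms. -/
def size : Word B → ℕ
  | atom _ => 1
  | @node _ _ _ f => ∑ i, (f i).size

/-- The set of colors that occur in a word. -/
def colors : Word B → Set B
  | atom b => {b}
  | node _ f => ⋃ i, (f i).colors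

theorem colors_map (c : B → C) (w : Word B) : (w.map c).colors = c '' w.colors := by
  induction w with
  | atom b => simp [map, colors]
  | node p f ih => simp [map, colors, ih, Set.image_iUnion]

/-- The equivalence of colored proto-objects: equality of colors on atoms; componentwise on
sequences; componentwise up to a circular shift on cycles, up to a permutation on multisets. -/
inductive Equiv : Word B → Word B → Prop
  | atom (b : B) : Equiv (atom b) (atom b)
  | node (p : Paren) {n : ℕ} (f g : Fin n → Word B) (σ : Equiv.Perm (Fin n)) (hσ : σ ∈ p.sym n)
      (h : ∀ i, Equiv (f i) (g (σ i))) : Equiv (node p f) (node p g)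

theorem Equiv.refl (w : Word B) : Equiv w w := by
  induction w with
  | atom b => exact .atom b
  | node p f ih => exact .node p f f 1 (one_mem _) ih

theorem Equiv.symm {v w : Word B} (h : Equiv v w) : Equiv w v := by
  induction h with
  | atom b => exact .atom b
  | node p f g σ hσ _ ih =>
    exact .node p g f σ⁻¹ (inv_mem hσ) fun i => by simpa using ih (σ⁻¹ i)

theorem Equiv.trans {u v w : Word B} (h : Equiv u v) (h' : Equiv v w) : Equiv u w := by
  induction h generalizing w with
  | atom b => exact h'
  | node p f g σ hσ _ ih =>
    cases h' with
    | node _ _ g' τ hτ h2 =>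
      exact .node p f g' (τ * σ) (mul_mem hτ hσ) fun i => ih i (h2 (σ i))

theorem Equiv.size_eq {v w : Word B} (h : Equiv v w) : v.size = w.size := by
  induction h with
  | atom b => rfl
  | node p f g σ hσ _ ih =>
    simp only [size, ih]
    exact Equiv.sum_comp σ fun i => (g i).size

instance setoid (B : Type) : Setoid (Word B) :=
  ⟨Equiv, Equiv.refl, Equiv.symm, Equiv.trans⟩

end Word

/-- `B`-colored combinatorial objects. -/
def Obj (B : Type) : Type := Quotient (Word.setoid B)

/-- The object represented by a word. -/
def Obj.mk {B : Type} (w : Word B) : Obj B := Quotient.mk _ w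

/-- The size of an object: the number of atoms of any representing word. -/
def Obj.size {B : Type} : Obj B → ℕ := Quotient.lift Word.size fun _ _ h => h.size_eq

/-! ## Constructible classes -/

/-- Class expressions over a set `ι` of class names. -/
inductive ClassExpr (ι : Type u) : Type u
  /-- the class reduced to one neutral object (a word without atoms, such as `()`) -/
  | neutral (w : Word Empty) : ClassExpr ι
  /-- the atomic class -/
  | atom : ClassExpr ι
  /-- a class defined by the (possibly recursive) specification -/
  | name (i : ι) : ClassExpr ι
  | sum (a b : ClassExpr ι) : ClassExpr ι
  | prod (a b : ClassExpr ι) : ClassExpr ι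
  | seq (a : ClassExpr ι) : ClassExpr ι
  | diag (k : ℕ+) (a : ClassExpr ι) : ClassExpr ι
  | mset (a : ClassExpr ι) : ClassExpr ι
  | cyc (a : ClassExpr ι) : ClassExpr ι

/-- Representatives of the members of the class given by an expression, for the specification
`𝒯 i = spec i` (`i : ι`), with atoms colored in `B`. A representative is a finite construction of
an object by the builders, so recursive specifications get their least solution. The two copies in
a union are kept apart (union of multisets). -/
inductive Rep {ι : Type u} (spec : ι → ClassExpr ι) (B : Type) : ClassExpr ι → Type u
  | neutral (w : Word Empty) : Rep spec B (.neutral w)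
  | atom (b : B) : Rep spec B .atom
  | name (i : ι) (d : Rep spec B (spec i)) : Rep spec B (.name i)
  | inl {a b : ClassExpr ι} (d : Rep spec B a) : Rep spec B (.sum a b)
  | inr {a b : ClassExpr ι} (d : Rep spec B b) : Rep spec B (.sum a b)
  | pair {a b : ClassExpr ι} (d : Rep spec B a) (d' : Rep spec B b) : Rep spec B (.prod a b)
  | seq {a : ClassExpr ι} (n : ℕ) (f : Fin n → Rep spec B a) : Rep spec B (.seq a)
  | diag (k : ℕ+) {a : ClassExpr ι} (d : Rep spec B a) : Rep spec B (.diag k a)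
  | mset {a : ClassExpr ι} (n : ℕ) (f : Fin n → Rep spec B a) : Rep spec B (.mset a)
  | cyc {a : ClassExpr ι} (n : ℕ) (hn : 0 < n) (f : Fin n → Rep spec B a) : Rep spec B (.cyc a)

namespace Rep

variable {ι : Type u} {spec : ι → ClassExpr ι} {B : Type}

/-- The word that is constructed: `A × B` gives `(AB)`, `Seq` gives `(A₁…Aₙ)`, `Δₖ` gives the
`k`-fold repetition `(A…A)`, `MSet` gives `{A₁…Aₙ}`, `Cyc` gives `[A₁…Aₙ]`. -/
def word : {a : ClassExpr ι} → Rep spec B a → Word B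
  | _, neutral w => w.map Empty.elim
  | _, atom b => .atom b
  | _, name _ d => d.word
  | _, inl d => d.word
  | _, inr d => d.word
  | _, pair d d' => .node .seq ![d.word, d'.word]
  | _, seq _ f => .node .seq fun i => (f i).word
  | _, diag k d => .node .seq fun _ : Fin k => d.word
  | _, mset _ f => .node .mset fun i => (f i).word
  | _, cyc _ _ f => .node .cyc fun i => (f i).word

/-- Two representatives give the same member of the class: multisets are taken up to permutation
and cycles up to circular shift, recursively. -/
inductive Equiv : {a : ClassExpr ι} → Rep spec B a → Rep spec B a → Prop
  | neutral (w : Word Empty) : Equiv (neutral w) (neutral w)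
  | atom (b : B) : Equiv (atom b) (atom b)
  | name (i : ι) {d e : Rep spec B (spec i)} (h : Equiv d e) : Equiv (name i d) (name i e)
  | inl {a b : ClassExpr ι} {d e : Rep spec B a} (h : Equiv d e) :
      Equiv (inl (b := b) d) (inl e)
  | inr {a b : ClassExpr ι} {d e : Rep spec B b} (h : Equiv d e) :
      Equiv (inr (a := a) d) (inr e)
  | pair {a b : ClassExpr ι} {d e : Rep spec B a} {d' e' : Rep spec B b} (h : Equiv d e)
      (h' : Equiv d' e') : Equiv (pair d d') (pair e e')
  | seq {a : ClassExpr ι} {n : ℕ} {f g : Fin n → Rep spec B a} (h : ∀ i, Equiv (f i) (g i)) :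
      Equiv (seq n f) (seq n g)
  | diag (k : ℕ+) {a : ClassExpr ι} {d e : Rep spec B a} (h : Equiv d e) :
      Equiv (diag k d) (diag k e)
  | mset {a : ClassExpr ι} {n : ℕ} {f g : Fin n → Rep spec B a} (σ : Equiv.Perm (Fin n))
      (h : ∀ i, Equiv (f i) (g (σ i))) : Equiv (mset n f) (mset n g)
  | cyc {a : ClassExpr ι} {n : ℕ} {hn : 0 < n} {f g : Fin n → Rep spec B a}
      (σ : Equiv.Perm (Fin n)) (hσ : σ ∈ Subgroup.zpowers (finRotate n))
      (h : ∀ i, Equiv (f i) (g (σ i))) : Equiv (cyc n hn f) (cyc n hn g)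

theorem Equiv.refl {a : ClassExpr ι} (d : Rep spec B a) : Equiv d d := by
  induction d with
  | neutral w => exact .neutral w
  | atom b => exact .atom b
  | name i d ih => exact .name i ih
  | inl d ih => exact .inl ih
  | inr d ih => exact .inr ih
  | pair d d' ih ih' => exact .pair ih ih'
  | seq n f ih => exact .seq ih
  | diag k d ih => exact .diag k ih
  | mset n f ih => exact .mset 1 ih
  | cyc n hn f ih => exact .cyc 1 (one_mem _) ih

theorem Equiv.symm {a : ClassExpr ι} {d e : Rep spec B a} (h : Equiv d e) : Equiv e d := by
  induction h with
  | neutral w => exact .neutral w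
  | atom b => exact .atom b
  | name i _ ih => exact .name i ih
  | inl _ ih => exact .inl ih
  | inr _ ih => exact .inr ih
  | pair _ _ ih ih' => exact .pair ih ih'
  | seq _ ih => exact .seq ih
  | diag k _ ih => exact .diag k ih
  | mset σ _ ih => exact .mset σ⁻¹ fun i => by simpa using ih (σ⁻¹ i)
  | cyc σ hσ _ ih => exact .cyc σ⁻¹ (inv_mem hσ) fun i => by simpa using ih (σ⁻¹ i)

theorem Equiv.trans {a : ClassExpr ι} {d e e' : Rep spec B a} (h : Equiv d e) (h' : Equiv e e') :
    Equiv d e' := by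
  induction h with
  | neutral w => exact h'
  | atom b => exact h'
  | name i _ ih => cases h' with | name _ h2 => exact .name i (ih h2)
  | inl _ ih => cases h' with | inl h2 => exact .inl (ih h2)
  | inr _ ih => cases h' with | inr h2 => exact .inr (ih h2)
  | pair _ _ ih ih' => cases h' with | pair h2 h3 => exact .pair (ih h2) (ih' h3)
  | seq _ ih => cases h' with | seq h2 => exact .seq fun i => ih i (h2 i)
  | diag k _ ih => cases h' with | diag _ h2 => exact .diag k (ih h2)
  | mset σ _ ih =>
    cases h' with | mset τ h2 => exact .mset (τ * σ) fun i => ih i (h2 (σ i))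
  | cyc σ hσ _ ih =>
    cases h' with
    | cyc τ hτ h2 => exact .cyc (τ * σ) (mul_mem hτ hσ) fun i => ih i (h2 (σ i))

theorem Equiv.word {a : ClassExpr ι} {d e : Rep spec B a} (h : Equiv d e) :
    Word.Equiv d.word e.word := by
  induction h with
  | neutral w => exact .refl _
  | atom b => exact .refl _
  | name i _ ih => exact ih
  | inl _ ih => exact ih
  | inr _ ih => exact ih
  | pair _ _ ih ih' =>
    refine .node .seq _ _ 1 (one_mem _) fun i => ?_
    fin_cases i
    · exact ih
    · exact ih'
  | seq _ ih => exact .node .seq _ _ 1 (one_mem _) ih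
  | diag k _ ih => exact .node .seq _ _ 1 (one_mem _) fun _ => ih
  | mset σ _ ih => exact .node .mset _ _ σ (Subgroup.mem_top _) ih
  | cyc σ hσ _ ih => exact .node .cyc _ _ σ hσ ih

instance setoid (spec : ι → ClassExpr ι) (B : Type) (a : ClassExpr ι) : Setoid (Rep spec B a) :=
  ⟨Equiv, Equiv.refl, Equiv.symm, Equiv.trans⟩

end Rep

/-- The members of the class `a` with atoms colored in `B`; for `B = Fin t` this is the
`t`-colored class. -/
def Member {ι : Type u} (spec : ι → ClassExpr ι) (B : Type) (a : ClassExpr ι) : Type u :=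
  Quotient (Rep.setoid spec B a)

/-- The colored object underlying a member. -/
def Member.obj {ι : Type u} {spec : ι → ClassExpr ι} {B : Type} {a : ClassExpr ι} :
    Member spec B a → Obj B :=
  Quotient.lift (fun d => Obj.mk d.word) fun _ _ h => Quotient.sound h.word

/-- The multiplicity of a colored object in the class `a`: a class is a multiset of objects. -/
def mult {ι : Type u} (spec : ι → ClassExpr ι) {B : Type} (a : ClassExpr ι) (o : Obj B) : ℕ∞ :=
  {m : Member spec B a | m.obj = o}.encard

/-! ## The multivariate generating function, evaluated at nonnegative parameters -/

/-- Values of the parameters `s₁, s₂, …`. -/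
abbrev Params : Type := ℕ+ → ℝ≥0∞

/-- `(s₁, s₂, …) ↦ (sₖ, s₂ₖ, …)`. -/
def Params.dilate (k : ℕ+) (s : Params) : Params := fun i => s (k * i)

/-- `exp y`, with `exp ∞ = ∞`. -/
def expPos (y : ℝ≥0∞) : ℝ≥0∞ := EReal.exp (y : EReal)

/-- `exp (-y)`, with `exp (-∞) = 0`. -/
def expNeg (y : ℝ≥0∞) : ℝ≥0∞ := EReal.exp (-(y : EReal))

/-- `-ln (1 - y)`, which is `∞` for `y ≥ 1`. -/
def negLog (y : ℝ≥0∞) : ℝ≥0∞ := (-(ENNReal.log (1 - y))).toENNReal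

/-- The building rules of the generating function, given the generating functions `F` of the named
classes. Values are in `[0, ∞]`, with `∞` where a series diverges; in particular
`(1 - y)⁻¹ = ∞` for `y ≥ 1`. -/
def ClassExpr.gf {ι : Type u} (F : ι → Params → ℝ≥0∞) : ClassExpr ι → Params → ℝ≥0∞
  | neutral _, _ => 1
  | atom, s => s 1
  | name i, s => F i s
  | sum a b, s => a.gf F s + b.gf F s
  | prod a b, s => a.gf F s * b.gf F s
  | seq a, s => (1 - a.gf F s)⁻¹
  | diag k a, s => a.gf F (s.dilate k)
  | mset a, s => expPos (∑' k : ℕ+, a.gf F (s.dilate k) / (k : ℕ))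
  | cyc a, s => ∑' k : ℕ+, (Nat.totient k : ℝ≥0∞) / (k : ℕ) * negLog (a.gf F (s.dilate k))

/-- Iteration of the system `F i = gf (spec i)` from `0`. -/
def gfIter {ι : Type u} (spec : ι → ClassExpr ι) : ℕ → ι → Params → ℝ≥0∞
  | 0 => fun _ _ => 0
  | n + 1 => fun i => (spec i).gf (gfIter spec n)

/-- The generating function `F_a (s₁, s₂, …)` of the class `a` under the specification: the named
classes get the least solution of the system. -/
def genFun {ι : Type u} (spec : ι → ClassExpr ι) (a : ClassExpr ι) : Params → ℝ≥0∞ :=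
  a.gf fun i s => ⨆ n, gfIter spec n i s

/-- The substitution `sᵢ = t xⁱ`. -/
def colorParams (t : ℕ) (x : ℝ≥0) : Params := fun i => (t : ℝ≥0∞) * (x : ℝ≥0∞) ^ (i : ℕ)

/-! ## Profiled objects -/

/-- A concatenation `A₁…Aₙ` of words with a profile, that is, a set-partition of its atoms into
nonempty parts. The parts are numbered, and each atom is marked with the part it belongs to. -/
structure ProfConcat where
  parts : ℕ
  len : ℕ
  words : Fin len → Word (Fin parts)
  onto : ∀ p, ∃ i, p ∈ (words i).colors

/-- A profiled object: a word with a set-partition of its atoms. -/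
structure Profiled where
  parts : ℕ
  word : Word (Fin parts)
  onto : ∀ p, p ∈ word.colors

/-- The word `□`, with its only profile. -/
def Profiled.atom : Profiled := ⟨1, .atom 0, fun p => Subsingleton.elim 0 p ▸ rfl⟩

/-- A neutral object, with its empty profile. -/
def Profiled.neutral (w : Word Empty) : Profiled := ⟨0, w.map Empty.elim, fun p => p.elim0⟩

/-- The empty concatenation. -/
def ProfConcat.empty : ProfConcat := ⟨0, 0, fun i => i.elim0, fun p => p.elim0⟩

/-- One word, as a concatenation. -/
def Profiled.single (a : Profiled) : ProfConcat := ⟨a.parts, 1, fun _ => a.word, fun p => ⟨0, a.onto p⟩⟩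

/-- Concatenation; the profile is the (disjoint) union of the profiles. -/
def ProfConcat.append (a b : ProfConcat) : ProfConcat where
  parts := a.parts + b.parts
  len := a.len + b.len
  words := Fin.append (fun i => (a.words i).map (Fin.castAdd b.parts))
    fun i => (b.words i).map (Fin.natAdd a.parts)
  onto p := by
    induction p using Fin.addCases with
    | left p =>
      obtain ⟨i, hi⟩ := a.onto p
      exact ⟨Fin.castAdd _ i, by
        rw [Fin.append_left, Word.colors_map]; exact ⟨p, hi, rfl⟩⟩
    | right p =>
      obtain ⟨i, hi⟩ := b.onto p
      exact ⟨Fin.natAdd _ i, by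
        rw [Fin.append_right, Word.colors_map]; exact ⟨p, hi, rfl⟩⟩

/-- The diagonal `δₖ`: the concatenation is repeated `k` times, and every part of the profile is
joined with its copies. -/
def ProfConcat.diag (k : ℕ+) (a : ProfConcat) : ProfConcat where
  parts := a.parts
  len := k * a.len
  words := Fin.repeat k a.words
  onto p := by
    obtain ⟨i, hi⟩ := a.onto p
    have hlt : (i : ℕ) < k * a.len := lt_of_lt_of_le i.2 (Nat.le_mul_of_pos_left _ k.pos)
    refine ⟨⟨i, hlt⟩, ?_⟩
    have : Fin.modNat (⟨i, hlt⟩ : Fin (k * a.len)) = i := Fin.ext (Nat.mod_eq_of_lt i.2)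
    rw [Fin.repeat_apply, this]
    exact hi

/-- Putting a concatenation between parentheses; the profile is unchanged. -/
def ProfConcat.enclose (q : Paren) (a : ProfConcat) : Profiled :=
  ⟨a.parts, .node q a.words, fun p => by simpa [Word.colors] using a.onto p⟩

/-! ## Random programs

The behaviour of a random program with outputs in `α` is the function giving, for each `a : α`, the
probability that it halts with output `a`. -/

/-- Output laws of random programs that may fail to halt. -/
abbrev Law (α : Type) : Type := α → ℝ≥0∞

open Classical in
/-- `return a`. -/
def Law.ret {α : Type} (a : α) : Law α := fun b => if b = a then 1 else 0

/-- Draw `a` from `p`, then run `f a`. -/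
def Law.bind {α β : Type} (p : Law α) (f : α → Law β) : Law β := fun b => ∑' a, p a * f a b

/-- The Bernoulli law. -/
def bern (p : ℝ≥0∞) : Law Bool := fun b => if b then p else 1 - p

/-- The geometric law. -/
def geom (l : ℝ≥0∞) : Law ℕ := fun k => l ^ k * (1 - l)

/-- The Poisson law (for `l = 0` it is concentrated at `0`). -/
def poisson (l : ℝ≥0∞) : Law ℕ := fun k => expNeg l * (l ^ k / (Nat.factorial k : ℝ≥0∞))

/-- The Poisson law conditioned to be positive. -/
def poissonPos (l : ℝ≥0∞) : Law ℕ := fun k =>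
  if k = 0 then 0 else (expPos l - 1)⁻¹ * (l ^ k / (Nat.factorial k : ℝ≥0∞))

/-- The distribution function `P(K ≤ k) = ∏_{j > k} exp (-F(s_j, s_{2j}, …) / j)`, where `F j` stands
for `F(s_j, s_{2j}, …)`. -/
def msetCdf (F : ℕ+ → ℝ≥0∞) (k : ℕ+) : ℝ≥0∞ :=
  expNeg (∑' j : ℕ+, if k < j then F j / (j : ℕ) else 0)

/-- The law of `K` in the sampler for multisets. -/
def msetLaw (F : ℕ+ → ℝ≥0∞) : Law ℕ+ := fun k =>
  if k = 1 then msetCdf F 1 else msetCdf F k - msetCdf F (k - 1)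

/-- The law of `K` in the sampler for cycles. -/
def cycLaw (F : ℕ+ → ℝ≥0∞) : Law ℕ+ := fun k =>
  (Nat.totient k : ℝ≥0∞) / (k : ℕ) * negLog (F k) /
    ∑' j : ℕ+, (Nat.totient j : ℝ≥0∞) / (j : ℕ) * negLog (F j)

/-- The logarithmic law. -/
def logLaw (y : ℝ≥0∞) : Law ℕ+ := fun l => y ^ (l : ℕ) / (l : ℕ) / negLog y

/-- Concatenate `q` independent draws from `p`. -/
def concatDraws (p : Law ProfConcat) : ℕ → Law ProfConcat
  | 0 => Law.ret .empty
  | q + 1 => (concatDraws p q).bind fun S => p.bind fun A => Law.ret (S.append A)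

/-- Append to `S` a number of independent draws from `p`, the number being drawn from `N`. -/
def appendBatch (N : Law ℕ) (p : Law ProfConcat) (S : ProfConcat) : Law ProfConcat :=
  N.bind fun q => (concatDraws p q).bind fun T => Law.ret (S.append T)

/-- The loop `for j from 1 to m` of the sampler for multisets; `p j` draws from the `j`-th
diagonal. -/
def msetLoop (F : ℕ+ → ℝ≥0∞) (p : ℕ+ → Law ProfConcat) : ℕ → Law ProfConcat
  | 0 => Law.ret .empty
  | m + 1 => (msetLoop F p m).bind
      (appendBatch (poisson (F m.succPNat / ((m + 1 : ℕ) : ℝ≥0∞))) (p m.succPNat))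

/-- The samplers for profiled objects, where `R` says what a call to the sampler of a named class
does. -/
def ClassExpr.sample {ι : Type u} (spec : ι → ClassExpr ι) (R : ι → Params → Law Profiled) :
    ClassExpr ι → Params → Law Profiled
  | neutral w, _ => Law.ret (.neutral w)
  | atom, _ => Law.ret .atom
  | name i, s => R i s
  | sum a b, s =>
      (bern (genFun spec a s / genFun spec (sum a b) s)).bind fun X =>
        if X then a.sample spec R s else b.sample spec R s
  | prod a b, s =>
      (a.sample spec R s).bind fun A => (b.sample spec R s).bind fun B =>
        Law.ret ((A.single.append B.single).enclose .seq)
  | seq a, s =>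
      (geom (genFun spec a s)).bind fun k =>
        (concatDraws ((a.sample spec R s).bind fun A => Law.ret A.single) k).bind fun S =>
          Law.ret (S.enclose .seq)
  | diag k a, s =>
      (a.sample spec R (s.dilate k)).bind fun A => Law.ret ((A.single.diag k).enclose .seq)
  | mset a, s =>
      let F : ℕ+ → ℝ≥0∞ := fun j => genFun spec a (s.dilate j)
      let p : ℕ+ → Law ProfConcat := fun j =>
        (a.sample spec R (s.dilate j)).bind fun A => Law.ret (A.single.diag j)
      (msetLaw F).bind fun k =>
        (if k = 1 then msetLoop F p 1
          else (msetLoop F p k.natPred).bind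
            (appendBatch (poissonPos (F k / (k : ℕ))) (p k))).bind fun S =>
          Law.ret (S.enclose .mset)
  | cyc a, s =>
      let F : ℕ+ → ℝ≥0∞ := fun j => genFun spec a (s.dilate j)
      (cycLaw F).bind fun k =>
        (logLaw (F k)).bind fun l =>
          (concatDraws ((a.sample spec R (s.dilate k)).bind fun A => Law.ret A.single) l).bind
            fun M => Law.ret ((M.diag k).enclose .cyc)

/-- The sampler of a named class, stopped when the nesting of recursive calls exceeds the bound. -/
def sampleIter {ι : Type u} (spec : ι → ClassExpr ι) : ℕ → ι → Params → Law Profiled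
  | 0 => fun _ _ _ => 0
  | n + 1 => fun i => (spec i).sample spec (sampleIter spec n)

/-- The sampler `Γ a (s₁, s₂, …)` for profiled objects: the probability of each output is the
(increasing) limit of the probabilities with bounded nesting of recursive calls. -/
def profiledSampler {ι : Type u} (spec : ι → ClassExpr ι) (a : ClassExpr ι) (s : Params) :
    Law Profiled :=
  fun P => ⨆ n, a.sample spec (sampleIter spec n) s P

/-- Independent uniform colors in a set of `t` colors, one for each of `m` parts. -/
def uniformColors (t m : ℕ) : Law (Fin m → Fin t) := fun _ => ∏ _p : Fin m, (t : ℝ≥0∞)⁻¹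

/-- Draw a profiled object with parameters `sᵢ = t xⁱ`, draw a uniform color for each part of its
profile, give each atom the color of its part, and return the resulting `t`-colored object. -/
def coloredSampler {ι : Type u} (spec : ι → ClassExpr ι) (a : ClassExpr ι) (t : ℕ) (x : ℝ≥0) :
    Law (Obj (Fin t)) :=
  (profiledSampler spec a (colorParams t x)).bind fun P =>
    (uniformColors t P.parts).bind fun c => Law.ret (Obj.mk (P.word.map c))

end

end ColoredBoltzmann

namespace ColoredBoltzmann

noncomputable section

/-! ## Expectations of test functions -/

/-! The proof works with expectations of test functions rather than with single probabilities. For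
every `φ` on colored objects, the generating function times the expectation of `φ` at the output
(averaged over the colorings of the profile) equals the sum of `x ^ |m| * φ m` over the members `m`
of the colored class: `genFun_mul_expect_profiledSampler`. Taking `φ = 1` gives total mass `1`,
because the generating function is itself the sum of the `x ^ |m|` (`genFun_colorParams`); taking
the indicator of an object gives its probability.

The identity is proved by structural induction on the class expression, for all `x` at once:
dilating `sᵢ = t xⁱ` by `k` replaces `x` by `x ^ k`, and the weight of a member at `x ^ k` is the
`k`-th power of its weight at `x`. Multiplying by the generating function cancels the normalising
constants of the random choices. A diagonal joins the copies of each part, so a part is colored once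
however often it is repeated; for a single atom this matches the parameter `t xᵏ`.

Multisets: expanding `exp (∑ F(s_j, …) / j)` yields batches, the `j`-th consisting of `q` elements
taken `j` times each, with coefficient `1 / (j ^ q q!)`. Each multiset receives its own weight in
total (`loopSum_indicator`), by counting the ways to remove `j` copies of one element. The variable
`K` is the index of the last nonempty batch, or `1`, so the sum over `K` telescopes
(`expPos_mul_expect_mset`).

Cycles: a cycle is a sequence of length `l` repeated `k` times, and Burnside counting shows that the
weights `φ(k) / (k l)` give each cycle total weight `1` (`tsum_cycle`).

Recursion: the sampler with nesting bounded by `n` corresponds to weights that vanish on members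
nested deeper than `n`, while the normalising constant is the full generating function at every `n`.
The missing mass is that of the deep members, and monotone convergence removes it; this is
termination with probability `1`. -/

theorem tsum_iSup_of_monotone {α : Type*} {f : ℕ → α → ℝ≥0∞} (hf : Monotone f) :
    ∑' a, ⨆ n, f n a = ⨆ n, ∑' a, f n a := by
  simp_rw [ENNReal.tsum_eq_iSup_sum]
  rw [iSup_comm]
  refine iSup_congr fun s => ?_
  exact ENNReal.finsetSum_iSup_of_monotone fun a m n h => hf h a

/-- The expectation of a test function. -/
def Law.expect {α : Type} (L : Law α) (g : α → ℝ≥0∞) : ℝ≥0∞ := ∑' a, L a * g a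

theorem Law.expect_ret {α : Type} (a : α) (g : α → ℝ≥0∞) : (Law.ret a).expect g = g a := by
  classical
  rw [Law.expect, tsum_eq_single a]
  · simp [Law.ret]
  · intro b hb
    simp [Law.ret, hb]

theorem Law.expect_bind {α β : Type} (p : Law α) (f : α → Law β) (g : β → ℝ≥0∞) :
    (p.bind f).expect g = p.expect fun a => (f a).expect g := by
  simp only [Law.expect, Law.bind, ← ENNReal.tsum_mul_right, ← ENNReal.tsum_mul_left]
  rw [ENNReal.tsum_comm]
  simp only [mul_assoc]

theorem Law.expect_const_mul {α : Type} (p : Law α) (c : ℝ≥0∞) (g : α → ℝ≥0∞) :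
    p.expect (fun a => c * g a) = c * p.expect g := by
  simp only [Law.expect, ← ENNReal.tsum_mul_left]
  exact tsum_congr fun a => by ring

theorem Law.expect_iSup {α : Type} {p : ℕ → Law α} (hp : Monotone p) (g : α → ℝ≥0∞) :
    Law.expect (fun a => ⨆ n, p n a) g = ⨆ n, (p n).expect g := by
  simp only [Law.expect, ENNReal.iSup_mul]
  exact tsum_iSup_of_monotone fun m n h a => mul_le_mul_left (hp h a) _

theorem Law.bind_mono {α β : Type} {p p' : Law α} {f f' : α → Law β} (hp : p ≤ p')
    (hf : ∀ a, f a ≤ f' a) : p.bind f ≤ p'.bind f' :=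
  fun b => ENNReal.tsum_le_tsum fun a => mul_le_mul' (hp a) (hf a b)

/-! ## Objects built from lists of objects -/

variable {B : Type}

/-- A list of objects between parentheses. -/
def Obj.node (p : Paren) (l : List (Obj B)) : Obj B :=
  Obj.mk (.node p fun i : Fin l.length => (l.get i).out)

theorem Obj.mk_eq_mk {v w : Word B} : Obj.mk v = Obj.mk w ↔ Word.Equiv v w := Quotient.eq

theorem Obj.mk_out (o : Obj B) : Obj.mk o.out = o := Quotient.out_eq o

theorem Obj.mk_node_congr {p : Paren} {n : ℕ} {f g : Fin n → Word B}
    (h : ∀ i, Obj.mk (f i) = Obj.mk (g i)) : Obj.mk (.node p f) = Obj.mk (.node p g) :=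
  Obj.mk_eq_mk.2 <| .node p f g 1 (one_mem _) fun i => Obj.mk_eq_mk.1 (h i)

theorem Obj.mk_node (p : Paren) {n : ℕ} (f : Fin n → Word B) :
    Obj.mk (.node p f) = Obj.node p (List.ofFn fun i => Obj.mk (f i)) := by
  -- The list is kept general, with only its length prescribed, so that substituting the length
  -- equation removes the casts.
  have key : ∀ (l : List (Obj B)) (hl : l.length = n) (g : Fin n → Word B)
      (_ : ∀ i : Fin n, Obj.mk (g i) = l.get (i.cast hl.symm)),
      Obj.mk (.node p g) = Obj.node p l := by
    rintro l rfl g hg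
    exact Obj.mk_node_congr fun i => by rw [hg, Obj.mk_out]; rfl
  refine key _ (List.length_ofFn) f fun i => ?_
  simp

/-- `idxBij` sends each position to a position with the same entry in the other list; it is
injective, hence a permutation of the finite index set. -/
theorem exists_perm_of_ofFn_perm {α : Type*} {n : ℕ} {f g : Fin n → α}
    (h : (List.ofFn f).Perm (List.ofFn g)) : ∃ σ : Equiv.Perm (Fin n), ∀ i, f i = g (σ i) := by
  classical
  let τ : Fin n → Fin n := fun i =>
    (h.idxBij (i.cast List.length_ofFn.symm)).cast List.length_ofFn
  have hτ : Function.Injective τ := fun i j hij =>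
    Fin.cast_injective _ (h.subperm.idxInj_injective (Fin.cast_injective _ hij))
  refine ⟨Equiv.ofBijective τ (Finite.injective_iff_bijective.1 hτ), fun i => ?_⟩
  have := h.getElem_idxBij_eq_getElem (i.cast List.length_ofFn.symm)
  rw [List.getElem_ofFn, List.getElem_ofFn] at this
  exact this.symm

theorem Obj.node_mset_perm {l l' : List (Obj B)} (h : l.Perm l') :
    Obj.node .mset l = Obj.node .mset l' := by
  obtain ⟨n, f, rfl⟩ : ∃ n, ∃ f : Fin n → Obj B, l = List.ofFn f :=
    ⟨_, _, (List.ofFn_get l).symm⟩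
  obtain ⟨m, g, rfl⟩ : ∃ n, ∃ f : Fin n → Obj B, l' = List.ofFn f :=
    ⟨_, _, (List.ofFn_get l').symm⟩
  obtain rfl : n = m := by simpa using h.length_eq
  obtain ⟨σ, hσ⟩ := exists_perm_of_ofFn_perm h
  obtain rfl : f = g ∘ σ := funext hσ
  have e : ∀ f : Fin n → Obj B,
      Obj.node .mset (List.ofFn f) = Obj.mk (.node .mset fun i => (f i).out) := fun f => by
    rw [Obj.mk_node]; simp only [Obj.mk_out]
  rw [e, e]
  exact Obj.mk_eq_mk.2 <| .node _ _ _ σ (Subgroup.mem_top _) fun i => .refl _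

theorem finRotate_pow_apply (n k : ℕ) (i : Fin n) :
    ((finRotate n ^ k) i : ℕ) = (i + k) % n := by
  induction k with
  | zero => simp [Nat.mod_eq_of_lt i.2]
  | succ k ih =>
    cases n with
    | zero => exact i.elim0
    | succ n =>
      rw [pow_succ', Equiv.Perm.mul_apply, finRotate_apply, Fin.val_add, ih]
      simp [← add_assoc]

/-- Translates the circular shifts of `Paren.sym` into `List.rotate`, so that cycles can be handled
through `Cycle`. -/
theorem ofFn_finRotate_pow {α : Type*} {n : ℕ} (f : Fin n → α) (k : ℕ) :
    List.ofFn (fun i => f ((finRotate n ^ k) i)) = (List.ofFn f).rotate k := by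
  refine List.ext_getElem (by simp) fun i h1 h2 => ?_
  rw [List.getElem_ofFn, List.getElem_rotate, List.getElem_ofFn]
  congr 1
  ext
  rw [finRotate_pow_apply]
  simp

theorem Obj.node_cyc_rotated {l l' : List (Obj B)} (h : l.IsRotated l') :
    Obj.node .cyc l = Obj.node .cyc l' := by
  obtain ⟨k, rfl⟩ := h
  obtain ⟨n, f, rfl⟩ : ∃ n, ∃ f : Fin n → Obj B, l = List.ofFn f :=
    ⟨_, _, (List.ofFn_get l).symm⟩
  have e : ∀ f : Fin n → Obj B,
      Obj.node .cyc (List.ofFn f) = Obj.mk (.node .cyc fun i => (f i).out) := fun f => by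
    rw [Obj.mk_node]; simp only [Obj.mk_out]
  rw [← ofFn_finRotate_pow, e, e]
  refine (Obj.mk_eq_mk.2 <| .node _ _ _ (finRotate n ^ k) ?_ fun i => .refl _).symm
  exact ⟨k, by simp⟩

/-- A multiset of objects as an object. -/
def Obj.mset (s : Multiset (Obj B)) : Obj B :=
  Quotient.lift (Obj.node .mset) (fun _ _ h => Obj.node_mset_perm h) s

/-- A cycle of objects as an object. -/
def Obj.cyc (s : Cycle (Obj B)) : Obj B :=
  Quot.lift (Obj.node .cyc) (fun _ _ h => Obj.node_cyc_rotated h) s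

/-! ## Averages over uniform colorings -/

variable {t : ℕ}

/-- The average of a test function over the colorings of the parts of a profile. -/
def Profiled.avg (φ : Obj (Fin t) → ℝ≥0∞) (P : Profiled) : ℝ≥0∞ :=
  ∑ c : Fin P.parts → Fin t, (t : ℝ≥0∞)⁻¹ ^ P.parts * φ (Obj.mk (P.word.map c))

/-- The average of a test function over the colorings of the parts of a profile. -/
def ProfConcat.avg (ψ : List (Obj (Fin t)) → ℝ≥0∞) (S : ProfConcat) : ℝ≥0∞ :=
  ∑ c : Fin S.parts → Fin t,
    (t : ℝ≥0∞)⁻¹ ^ S.parts * ψ (List.ofFn fun i => Obj.mk ((S.words i).map c))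

theorem Word.map_map {B C D : Type} (c : B → C) (d : C → D) (w : Word B) :
    (w.map c).map d = w.map (d ∘ c) := by
  induction w with
  | atom b => rfl
  | node p f ih => simp only [Word.map, ih]

theorem Word.size_map {B C : Type} (c : B → C) (w : Word B) : (w.map c).size = w.size := by
  induction w with
  | atom b => rfl
  | node p f ih => simp only [Word.map, Word.size, ih]

theorem Word.size_empty (w : Word Empty) : w.size = 0 := by
  induction w with
  | atom b => exact b.elim
  | node p f ih => simp [Word.size, ih]

theorem ProfConcat.avg_empty (ψ : List (Obj (Fin t)) → ℝ≥0∞) : ProfConcat.empty.avg ψ = ψ [] := by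
  have : Unique (Fin ProfConcat.empty.parts → Fin t) := Pi.uniqueOfIsEmpty (α := Fin 0) _
  rw [ProfConcat.avg, Fintype.sum_unique]
  simp [ProfConcat.empty]

/-- The parts of a concatenation are a disjoint union, so a coloring of them is a pair of
independent colorings. -/
theorem ProfConcat.avg_append (ψ : List (Obj (Fin t)) → ℝ≥0∞) (S T : ProfConcat) :
    (S.append T).avg ψ = S.avg fun l => T.avg fun l' => ψ (l ++ l') := by
  simp only [ProfConcat.avg, Finset.mul_sum]
  rw [← Fintype.sum_prod_type']
  refine (Fintype.sum_equiv (Fin.appendEquiv S.parts T.parts) _ _ fun c => ?_).symm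
  have h : List.ofFn (fun i => Obj.mk (((S.append T).words i).map
      (Fin.appendEquiv S.parts T.parts c))) =
      List.ofFn (fun i => Obj.mk ((S.words i).map c.1)) ++
        List.ofFn (fun i => Obj.mk ((T.words i).map c.2)) := by
    rw [← List.ofFn_fin_append]
    congr 1
    funext i
    induction i using Fin.addCases with
    | left i =>
      rw [Fin.append_left]
      simp only [ProfConcat.append, Fin.append_left, Word.map_map]
      congr 2
      funext p
      simp [Fin.appendEquiv]
    | right i =>
      rw [Fin.append_right]
      simp only [ProfConcat.append, Fin.append_right, Word.map_map]
      congr 2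
      funext p
      simp [Fin.appendEquiv]
  rw [← mul_assoc, ← pow_add]
  exact congrArg (fun l => (t : ℝ≥0∞)⁻¹ ^ (S.parts + T.parts) * ψ l) h.symm

theorem ProfConcat.avg_single (ψ : List (Obj (Fin t)) → ℝ≥0∞) (A : Profiled) :
    A.single.avg ψ = A.avg fun o => ψ [o] := by
  simp [ProfConcat.avg, Profiled.avg, Profiled.single]
  rfl

/-- Joining each part with its copies leaves the set of parts, and therefore the set of colorings,
unchanged. -/
theorem ProfConcat.avg_diag (ψ : List (Obj (Fin t)) → ℝ≥0∞) (k : ℕ+) (S : ProfConcat) :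
    (S.diag k).avg ψ = S.avg fun l => ψ (List.replicate k l).flatten := by
  simp only [ProfConcat.avg, ← List.ofFn_fin_repeat]
  rfl

theorem ProfConcat.avg_enclose (φ : Obj (Fin t) → ℝ≥0∞) (q : Paren) (S : ProfConcat) :
    (S.enclose q).avg φ = S.avg fun l => φ (Obj.node q l) := by
  simp only [ProfConcat.avg, Profiled.avg, ← Obj.mk_node]
  rfl

theorem Profiled.avg_atom (φ : Obj (Fin t) → ℝ≥0∞) :
    Profiled.atom.avg φ = (t : ℝ≥0∞)⁻¹ * ∑ b, φ (Obj.mk (.atom b)) := by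
  simp only [Profiled.avg, Finset.mul_sum]
  refine Fintype.sum_equiv (Equiv.funUnique (Fin 1) (Fin t)) _ _ fun c => ?_
  simp [Profiled.atom, Word.map]

theorem Profiled.avg_neutral (φ : Obj (Fin t) → ℝ≥0∞) (w : Word Empty) :
    (Profiled.neutral w).avg φ = φ (Obj.mk (w.map Empty.elim)) := by
  have : Unique (Fin (Profiled.neutral w).parts → Fin t) := Pi.uniqueOfIsEmpty (α := Fin 0) _
  rw [Profiled.avg, Fintype.sum_unique]
  simp only [Profiled.neutral, Word.map_map, pow_zero, one_mul]
  congr 3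
  funext e
  exact e.elim

/-! ## Weighted sums over sequences -/

section Sequences

variable {M : Type*}

/-- The sum of `ψ` over the sequences of `q` elements, each element `m` having weight `w m`. -/
def seqSum (w : M → ℝ≥0∞) : ℕ → (List M → ℝ≥0∞) → ℝ≥0∞
  | 0, ψ => ψ []
  | q + 1, ψ => seqSum w q fun l => ∑' m, w m * ψ (l ++ [m])

/-- Splitting off the last entry identifies nonempty lists with pairs of a list and an element. -/
theorem seqSum_eq_tsum (w : M → ℝ≥0∞) (q : ℕ) (ψ : List M → ℝ≥0∞) :
    seqSum w q ψ = ∑' l : List M, if l.length = q then (l.map w).prod * ψ l else 0 := by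
  induction q generalizing ψ with
  | zero =>
    rw [tsum_eq_single []]
    · simp [seqSum]
    · intro l hl
      simp [hl]
  | succ q ih =>
    let e : List M × M → List M := fun p => p.1 ++ [p.2]
    have he : Function.Injective e := fun p p' h => by
      have := List.append_inj' h rfl
      simpa [Prod.ext_iff] using this
    rw [seqSum, ih]
    refine Eq.trans ?_ (he.tsum_eq ?_)
    · rw [ENNReal.tsum_prod']
      refine tsum_congr fun l => ?_
      by_cases hl : l.length = q
      · simp [e, hl, ← ENNReal.tsum_mul_left, mul_assoc]
      · simp [e, hl]
    · intro l hl
      rcases List.eq_nil_or_concat l with rfl | ⟨l', m, rfl⟩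
      · simp at hl
      · exact ⟨(l', m), by simp [e]⟩

theorem tsum_seqSum (w : M → ℝ≥0∞) (ψ : List M → ℝ≥0∞) :
    ∑' q, seqSum w q ψ = ∑' l : List M, (l.map w).prod * ψ l := by
  simp_rw [seqSum_eq_tsum]
  rw [ENNReal.tsum_comm]
  refine tsum_congr fun l => (tsum_eq_single l.length fun q hq => if_neg hq.symm).trans ?_
  rw [if_pos rfl]

theorem seqSum_tsum {β : Type*} (w : M → ℝ≥0∞) (q : ℕ) (ψ : β → List M → ℝ≥0∞) :
    seqSum w q (fun l => ∑' b, ψ b l) = ∑' b, seqSum w q (ψ b) := by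
  simp_rw [seqSum_eq_tsum]
  rw [ENNReal.tsum_comm]
  refine tsum_congr fun l => ?_
  split_ifs
  · rw [ENNReal.tsum_mul_left]
  · simp

theorem seqSum_const_mul (w : M → ℝ≥0∞) (q : ℕ) (c : ℝ≥0∞) (ψ : List M → ℝ≥0∞) :
    seqSum w q (fun l => c * ψ l) = c * seqSum w q ψ := by
  simp_rw [seqSum_eq_tsum, ← ENNReal.tsum_mul_left]
  refine tsum_congr fun l => ?_
  split_ifs
  · ring
  · simp

theorem seqSum_congr (w : M → ℝ≥0∞) (q : ℕ) {ψ ψ' : List M → ℝ≥0∞}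
    (h : ∀ l, l.length = q → ψ l = ψ' l) : seqSum w q ψ = seqSum w q ψ' := by
  simp_rw [seqSum_eq_tsum]
  refine tsum_congr fun l => ?_
  split_ifs with hl
  · rw [h l hl]
  · rfl

theorem seqSum_const (w : M → ℝ≥0∞) (q : ℕ) (c : ℝ≥0∞) :
    seqSum w q (fun _ => c) = (∑' m, w m) ^ q * c := by
  induction q generalizing c with
  | zero => simp [seqSum]
  | succ q ih => rw [seqSum, ENNReal.tsum_mul_right, ih]; ring

end Sequences

/-! ## Multisets as Poisson batches -/

section Multisets

variable {M : Type*} (w : M → ℝ≥0∞)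

/-- The sum of `ψ` over the multisets formed by `j` copies of each of `q` elements, a sequence of
`q` elements having weight `1 / (j ^ q q!)` times the `j`-th power of its weight. -/
def batchSum (j : ℕ) (ψ : Multiset M → ℝ≥0∞) : ℝ≥0∞ :=
  ∑' q : ℕ, (j : ℝ≥0∞)⁻¹ ^ q / (q.factorial : ℝ≥0∞) *
    seqSum (fun m => w m ^ j) q fun l => ψ (j • (l : Multiset M))

/-- The sum of `ψ` over the unions of one batch for each `j ≤ J`. -/
def loopSum : ℕ → (Multiset M → ℝ≥0∞) → ℝ≥0∞
  | 0, ψ => ψ 0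
  | J + 1, ψ => loopSum J fun S => batchSum w (J + 1) fun T => ψ (S + T)

theorem batchSum_tsum {β : Type*} (j : ℕ) (ψ : β → Multiset M → ℝ≥0∞) :
    batchSum w j (fun S => ∑' b, ψ b S) = ∑' b, batchSum w j (ψ b) := by
  simp only [batchSum, seqSum_tsum, ← ENNReal.tsum_mul_left]
  rw [ENNReal.tsum_comm]

theorem batchSum_const_mul (j : ℕ) (c : ℝ≥0∞) (ψ : Multiset M → ℝ≥0∞) :
    batchSum w j (fun S => c * ψ S) = c * batchSum w j ψ := by
  simp only [batchSum, seqSum_const_mul, ← ENNReal.tsum_mul_left]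
  exact tsum_congr fun q => by ring

theorem loopSum_tsum {β : Type*} (J : ℕ) (ψ : β → Multiset M → ℝ≥0∞) :
    loopSum w J (fun S => ∑' b, ψ b S) = ∑' b, loopSum w J (ψ b) := by
  induction J generalizing ψ with
  | zero => rfl
  | succ J ih => simp only [loopSum, batchSum_tsum, ih]

theorem loopSum_const_mul (J : ℕ) (c : ℝ≥0∞) (ψ : Multiset M → ℝ≥0∞) :
    loopSum w J (fun S => c * ψ S) = c * loopSum w J ψ := by
  induction J generalizing ψ with
  | zero => rfl
  | succ J ih => simp only [loopSum, batchSum_const_mul, ih]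

theorem batchSum_add (j : ℕ) (ψ ψ' : Multiset M → ℝ≥0∞) :
    batchSum w j (fun S => ψ S + ψ' S) = batchSum w j ψ + batchSum w j ψ' := by
  simpa [tsum_bool, add_comm] using batchSum_tsum w j fun b : Bool => if b then ψ else ψ'

theorem loopSum_add (J : ℕ) (ψ ψ' : Multiset M → ℝ≥0∞) :
    loopSum w J (fun S => ψ S + ψ' S) = loopSum w J ψ + loopSum w J ψ' := by
  simpa [tsum_bool, add_comm] using loopSum_tsum w J fun b : Bool => if b then ψ else ψ'

/-- Isolates the empty batch. The remaining terms are those produced by a Poisson variable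
conditioned to be positive. -/
theorem batchSum_eq_zero_add (j : ℕ) (ψ : Multiset M → ℝ≥0∞) :
    batchSum w j ψ = ψ 0 + ∑' q : ℕ, (j : ℝ≥0∞)⁻¹ ^ (q + 1) / ((q + 1).factorial : ℝ≥0∞) *
      seqSum (fun m => w m ^ j) (q + 1) fun l => ψ (j • (l : Multiset M)) := by
  rw [batchSum, tsum_eq_zero_add' ENNReal.summable]
  simp [seqSum]

theorem le_batchSum (j : ℕ) (ψ : Multiset M → ℝ≥0∞) : ψ 0 ≤ batchSum w j ψ := by
  rw [batchSum_eq_zero_add]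
  exact le_self_add

theorem loopSum_mono {J : ℕ} {ψ ψ' : Multiset M → ℝ≥0∞} (h : ∀ S, ψ S ≤ ψ' S) :
    loopSum w J ψ ≤ loopSum w J ψ' := by
  -- Monotonicity follows from additivity: truncated subtraction is exact here because `ψ ≤ ψ'`.
  have : ψ' = fun S => ψ S + (ψ' S - ψ S) := funext fun S => (add_tsub_cancel_of_le (h S)).symm
  rw [this, loopSum_add]
  exact le_self_add

theorem loopSum_monotone (ψ : Multiset M → ℝ≥0∞) : Monotone fun J => loopSum w J ψ :=
  monotone_nat_of_le_succ fun J => loopSum_mono w fun S => by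
    simpa using le_batchSum w (J + 1) fun T => ψ (S + T)

/-- A batch of `q + 1` elements has `j (q + 1)` members, and this factor turns `1 / (j ^ (q + 1) (q
+ 1)!)` into `1 / (j ^ q q!)`. What remains is a batch of `q` elements and one further free element
taken `j` times. -/
theorem batchSum_card_mul {j : ℕ} (hj : j ≠ 0) (ψ : Multiset M → ℝ≥0∞) :
    batchSum w j (fun S => (S.card : ℝ≥0∞) * ψ S) =
      ∑' m, w m ^ j * batchSum w j fun S => ψ (S + j • {m}) := by
  rw [batchSum_eq_zero_add]
  simp only [batchSum, ← ENNReal.tsum_mul_left]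
  rw [ENNReal.tsum_comm]
  simp only [Multiset.card_zero, Nat.cast_zero, zero_mul, zero_add]
  refine tsum_congr fun q => ?_
  have h1 : seqSum (fun m => w m ^ j) (q + 1)
      (fun l => (((j • (l : Multiset M)).card : ℕ) : ℝ≥0∞) * ψ (j • (l : Multiset M))) =
      (j : ℝ≥0∞) * ((q + 1 : ℕ) : ℝ≥0∞) *
        ∑' m, w m ^ j * seqSum (fun m => w m ^ j) q fun l => ψ (j • (l : Multiset M) + j • {m}) := by
    rw [seqSum_congr _ _ (ψ' := fun l => (j : ℝ≥0∞) * ((q + 1 : ℕ) : ℝ≥0∞) *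
      ψ (j • (l : Multiset M)))]
    · rw [seqSum_const_mul, seqSum]
      simp only [← Multiset.coe_add, smul_add, Multiset.coe_singleton, seqSum_tsum,
        seqSum_const_mul]
    · intro l hl
      simp [hl]
  rw [h1, ← ENNReal.tsum_mul_left, ← ENNReal.tsum_mul_left]
  refine tsum_congr fun m => ?_
  have hj0 : (j : ℝ≥0∞) ≠ 0 := by exact_mod_cast hj
  have hq0 : ((q + 1 : ℕ) : ℝ≥0∞) ≠ 0 := by exact_mod_cast q.succ_ne_zero
  have h2 : (j : ℝ≥0∞)⁻¹ ^ (q + 1) / ((q + 1).factorial : ℝ≥0∞) * (j * ((q + 1 : ℕ) : ℝ≥0∞)) =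
      (j : ℝ≥0∞)⁻¹ ^ q / (q.factorial : ℝ≥0∞) := by
    rw [Nat.factorial_succ, Nat.cast_mul, div_eq_mul_inv,
      ENNReal.mul_inv (Or.inl hq0) (Or.inl (ENNReal.natCast_ne_top _)), pow_succ, div_eq_mul_inv]
    calc _ = (j : ℝ≥0∞)⁻¹ ^ q * (q.factorial : ℝ≥0∞)⁻¹ * ((j : ℝ≥0∞)⁻¹ * j) *
          (((q + 1 : ℕ) : ℝ≥0∞)⁻¹ * ((q + 1 : ℕ) : ℝ≥0∞)) := by ring
      _ = _ := by
        rw [ENNReal.inv_mul_cancel hj0 (ENNReal.natCast_ne_top _),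
          ENNReal.inv_mul_cancel hq0 (ENNReal.natCast_ne_top _), mul_one, mul_one]
  rw [← mul_assoc, h2]
  ring

/-- The cardinality is additive over the batches, so `batchSum_card_mul` applies to each of them in
turn, as in a product rule. -/
theorem loopSum_card_mul (J : ℕ) (ψ : Multiset M → ℝ≥0∞) :
    loopSum w J (fun S => (S.card : ℝ≥0∞) * ψ S) =
      ∑ j ∈ Finset.range J, ∑' m, w m ^ (j + 1) *
        loopSum w J fun S => ψ (S + (j + 1) • {m}) := by
  induction J generalizing ψ with
  | zero => simp [loopSum]
  | succ J ih =>
    simp only [loopSum, Multiset.card_add, Nat.cast_add, add_mul, batchSum_add, loopSum_add,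
      batchSum_const_mul]
    rw [Finset.sum_range_succ, ih]
    simp only [batchSum_card_mul w J.succ_ne_zero, loopSum_tsum, loopSum_const_mul, ← add_assoc,
      add_right_comm]

theorem loopSum_indicator_zero [DecidableEq M] (J : ℕ) :
    loopSum w J (fun T => if T = 0 then 1 else 0) = 1 := by
  induction J with
  | zero => simp [loopSum]
  | succ J ih =>
    rw [loopSum]
    refine Eq.trans ?_ ih
    congr 1
    funext S
    rw [batchSum_eq_zero_add, add_zero]
    have h0 : ∀ q : ℕ, seqSum (fun m => w m ^ (J + 1)) (q + 1)
        (fun l => if S + (J + 1) • (l : Multiset M) = 0 then (1 : ℝ≥0∞) else 0) = 0 := fun q => by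
      rw [seqSum_congr _ _ (ψ' := fun _ => 0), seqSum_const, mul_zero]
      intro l hl
      rw [if_neg]
      intro h
      have := congrArg Multiset.card h
      simp [hl] at this
    simp only [h0, mul_zero, tsum_zero, add_zero]

theorem sum_range_ite_le {c J : ℕ} (h : c ≤ J) :
    ∑ j ∈ Finset.range J, (if j + 1 ≤ c then (1 : ℝ≥0∞) else 0) = c := by
  rw [← Finset.sum_filter, Finset.sum_const, nsmul_one]
  congr 1
  rw [show (Finset.range J).filter (fun j => j + 1 ≤ c) = Finset.range c by
    ext j; simp only [Finset.mem_filter, Finset.mem_range]; omega, Finset.card_range]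

/-- Induction on `|S|`. By `loopSum_card_mul`, `|S|` times the left side is a sum over pairs `(j,
m)`; a pair contributes only if `S` contains `j` copies of `m`, and then `w m ^ j` times the weight
of what is left is the weight of `S`. There are `∑ count m S = |S|` such pairs, all with `j ≤ J`
since `|S| ≤ J`, and `|S|` cancels. -/
theorem loopSum_indicator [DecidableEq M] {J : ℕ} {S : Multiset M} (hS : S.card ≤ J) :
    loopSum w J (fun T => if T = S then 1 else 0) = (S.map w).prod := by
  induction hn : S.card using Nat.strong_induction_on generalizing S with
  | _ n ih =>
    subst hn
    rcases eq_or_ne S 0 with rfl | h0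
    · simpa using loopSum_indicator_zero w J
    have hc0 : (S.card : ℝ≥0∞) ≠ 0 := by simpa using h0
    refine (ENNReal.mul_right_inj hc0 (ENNReal.natCast_ne_top _)).1 ?_
    have h1 : (fun T : Multiset M => (S.card : ℝ≥0∞) * if T = S then 1 else 0) =
        fun T => (T.card : ℝ≥0∞) * if T = S then 1 else 0 := by
      funext T
      split_ifs with h
      · rw [h]
      · simp
    rw [← loopSum_const_mul, h1, loopSum_card_mul]
    have h2 : ∀ j m, w m ^ (j + 1) * loopSum w J
        (fun T => if T + (j + 1) • {m} = S then (1 : ℝ≥0∞) else 0) =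
        (if j + 1 ≤ S.count m then 1 else 0) * (S.map w).prod := fun j m => by
      split_ifs with h
      · obtain ⟨T, rfl⟩ : ∃ T, S = T + (j + 1) • {m} := by
          rw [Multiset.le_count_iff_replicate_le, ← Multiset.nsmul_singleton] at h
          exact ⟨S - (j + 1) • {m}, (tsub_add_cancel_of_le h).symm⟩
        simp only [add_left_inj]
        rw [ih T.card (by simp) (le_trans (by simp) hS) rfl, Multiset.map_add, Multiset.prod_add,
          Multiset.map_nsmul, Multiset.prod_nsmul, Multiset.map_singleton, Multiset.prod_singleton,
          one_mul, mul_comm]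
      -- The zero function is written `0 * 0` so that `loopSum_const_mul` can extract a factor `0`.
      · rw [zero_mul, show (fun T => if T + (j + 1) • {m} = S then (1 : ℝ≥0∞) else 0) =
          fun _ => 0 * 0 from funext fun T => ?_, loopSum_const_mul, zero_mul, mul_zero]
        rw [if_neg, zero_mul]
        rintro rfl
        simp at h
    simp only [h2, ENNReal.tsum_mul_right, ← Finset.sum_mul]
    congr 1
    rw [← Summable.tsum_finsetSum fun _ _ => ENNReal.summable]
    simp only [sum_range_ite_le ((Multiset.count_le_card _ S).trans hS)]
    rw [tsum_eq_sum (s := S.toFinset) fun m hm => by simpa using hm, ← Nat.cast_sum,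
      Multiset.toFinset_sum_count_eq]

theorem loopSum_eq_tsum [DecidableEq M] (J : ℕ) (ψ : Multiset M → ℝ≥0∞) :
    loopSum w J ψ = ∑' S, loopSum w J (fun T => if T = S then 1 else 0) * ψ S := by
  have : ψ = fun T => ∑' S, ψ S * if T = S then 1 else 0 := by
    funext T
    simp
  conv_lhs => rw [this]
  simp only [loopSum_tsum, loopSum_const_mul, mul_comm]

/-- The weight given to a fixed `S` increases with `J` and is constant once `J ≥ |S|`, so monotone
convergence applies. -/
theorem iSup_loopSum (ψ : Multiset M → ℝ≥0∞) :
    ⨆ J, loopSum w J ψ = ∑' S : Multiset M, (S.map w).prod * ψ S := by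
  classical
  simp only [fun J => loopSum_eq_tsum w J ψ]
  rw [← tsum_iSup_of_monotone (f := fun J S =>
    loopSum w J (fun T => if T = S then 1 else 0) * ψ S) fun J J' h S =>
      mul_le_mul_left (loopSum_monotone w _ h) _]
  refine tsum_congr fun S => ?_
  rw [← ENNReal.iSup_mul]
  congr 1
  refine le_antisymm (iSup_le fun J => ?_) ?_
  · exact (loopSum_monotone w _ (le_max_left J S.card)).trans
      (loopSum_indicator w (le_max_right _ _)).le
  · exact (loopSum_indicator w le_rfl).symm.le.trans (le_iSup (fun J => loopSum w J _) S.card)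

end Multisets

/-! ## Cycles as repeated sequences -/

section Cycles

variable {M : Type*}

theorem rotate_eq_self_add {h : List M} {r s : ℕ} (hr : h.rotate r = h) (hs : h.rotate s = h) :
    h.rotate (r + s) = h := by
  rw [← List.rotate_rotate, hr, hs]

theorem rotate_eq_self_mul {h : List M} {r : ℕ} (hr : h.rotate r = h) (s : ℕ) :
    h.rotate (r * s) = h := by
  induction s with
  | zero => simp
  | succ s ih => rw [Nat.mul_succ]; exact rotate_eq_self_add ih hr

/-- Bézout: the shifts fixing a list are closed under addition and include its length. -/
theorem rotate_eq_self_iff_gcd {h : List M} (r : ℕ) :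
    h.rotate r = h ↔ h.rotate (h.length.gcd r) = h := by
  constructor
  · intro hr
    rcases Nat.eq_zero_or_pos h.length with h0 | hpos
    · simp [List.length_eq_zero_iff.1 h0]
    -- `Nat.exists_mul_mod_eq_gcd` needs the gcd to be strictly below the modulus; in the case of
    -- equality the shift is a full turn.
    rcases (Nat.gcd_le_left r hpos).lt_or_eq with hlt | heq
    · rw [Nat.gcd_comm] at hlt ⊢
      obtain ⟨m, _, hm⟩ := Nat.exists_mul_mod_eq_gcd hlt
      rw [← hm, List.rotate_mod]
      exact rotate_eq_self_mul hr m
    · rw [heq, List.rotate_length]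
  · intro hg
    obtain ⟨s, hs⟩ := Nat.gcd_dvd_right h.length r
    rw [hs]
    exact rotate_eq_self_mul hg s

theorem length_flatten_replicate (k : ℕ) (L : List M) :
    (List.replicate k L).flatten.length = k * L.length := by
  simp

theorem getElem_flatten_replicate (k : ℕ) (L : List M) (i : ℕ)
    (hi : i < (List.replicate k L).flatten.length) (hi' : i % L.length < L.length) :
    (List.replicate k L).flatten[i] = L[i % L.length] := by
  obtain ⟨n, f, rfl⟩ : ∃ n, ∃ f : Fin n → M, L = List.ofFn f := ⟨_, _, (List.ofFn_get L).symm⟩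
  simp only [← List.ofFn_fin_repeat, List.getElem_ofFn, Fin.repeat_apply]
  congr 1
  ext
  simp

theorem rotate_flatten_replicate (k : ℕ) (L : List M) :
    (List.replicate k L).flatten.rotate L.length = (List.replicate k L).flatten := by
  cases k with
  | zero => simp
  | succ k =>
    conv_lhs => rw [List.replicate_succ, List.flatten_cons]
    rw [List.rotate_append_length_eq, List.replicate_succ', List.flatten_append]
    simp

/-- Invariance under the shift by `l` gives invariance under `l * (i / l)`, which makes entry `i`
equal to entry `i % l`. -/
theorem eq_flatten_replicate {h : List M} {k l : ℕ} (hl : 0 < l) (hn : h.length = k * l)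
    (hr : h.rotate l = h) : h = (List.replicate k (h.take l)).flatten := by
  rcases Nat.eq_zero_or_pos k with rfl | hk
  · simpa using hn
  have hlh : l ≤ h.length := hn ▸ Nat.le_mul_of_pos_left _ hk
  have hlt : (h.take l).length = l := by simpa using hlh
  refine List.ext_getElem (by rw [length_flatten_replicate, hlt, hn]) fun i h1 h2 => ?_
  have hm : i % l < l := Nat.mod_lt _ hl
  rw [getElem_flatten_replicate k _ i h2 (by rwa [hlt])]
  simp only [hlt, List.getElem_take]
  have hs := rotate_eq_self_mul hr (i / l)
  have h3 : (h.rotate (l * (i / l)))[i % l]'(by rw [hs]; omega) = h[i] := by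
    rw [List.getElem_rotate]
    congr 1
    rw [Nat.mod_add_div, Nat.mod_eq_of_lt h1]
  rw [← h3]
  congr 1

open Classical in
/-- The number of rotations fixing a list. -/
def rotFix (h : List M) : ℕ := ((Finset.range h.length).filter fun r => h.rotate r = h).card

theorem isRotated_iff_lt {h h' : List M} (hh : h ≠ []) :
    h.IsRotated h' ↔ ∃ s < h.length, h.rotate s = h' := by
  constructor
  · rintro ⟨n, rfl⟩
    exact ⟨n % h.length, Nat.mod_lt _ (List.length_pos_iff.2 hh), List.rotate_mod _ _⟩
  · rintro ⟨s, _, rfl⟩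
    exact ⟨s, rfl⟩

-- The shifts carrying `h` to `h'` form a coset of the stabiliser: if the shift `s` is one of them,
-- the others are `s + r` with `r` fixing `h'`.
open Classical in
theorem rotFix_eq_card {h h' : List M} (hr : h.IsRotated h') :
    rotFix h' = ((Finset.range h.length).filter fun r => h.rotate r = h').card := by
  rcases eq_or_ne h [] with rfl | hh
  · rw [List.isRotated_nil_iff'] at hr
    subst hr
    simp [rotFix]
  obtain ⟨s, hs, rfl⟩ := (isRotated_iff_lt hh).1 hr
  have hpos : 0 < h.length := List.length_pos_iff.2 hh
  refine Finset.card_bij (fun r _ => (s + r) % h.length) ?_ ?_ ?_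
  · intro r hr
    simp only [Finset.mem_filter, Finset.mem_range, List.rotate_rotate, List.length_rotate] at hr ⊢
    exact ⟨Nat.mod_lt _ hpos, by rw [List.rotate_mod, hr.2]⟩
  · intro r hr r' hr' he
    simp only [Finset.mem_filter, Finset.mem_range, List.length_rotate] at hr hr'
    have : r ≡ r' [MOD h.length] := Nat.ModEq.add_left_cancel' s he
    exact Nat.ModEq.eq_of_lt_of_lt this hr.1 hr'.1
  · intro r hr
    simp only [Finset.mem_filter, Finset.mem_range, List.rotate_rotate, List.length_rotate] at hr ⊢
    -- The preimage of `r` is `r - s` modulo the length; the length is added first so that the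
    -- subtraction does not truncate.
    have he : (s + (r + h.length - s) % h.length) % h.length = r := by
      rw [Nat.add_mod_mod, show s + (r + h.length - s) = r + h.length by omega,
        Nat.add_mod_right, Nat.mod_eq_of_lt hr.1]
    refine ⟨(r + h.length - s) % h.length, ⟨Nat.mod_lt _ hpos, ?_⟩, he⟩
    rw [← List.rotate_mod, he, hr.2]

-- Orbit-stabiliser: each of the `h.length` shifts of `h` lands on exactly one `h'`, and each `h'`
-- of the orbit is reached `rotFix h'` times.
open Classical in
theorem tsum_rotFix (h : List M) :
    ∑' h' : List M, (if h.IsRotated h' then (rotFix h' : ℝ≥0∞) else 0) = h.length := by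
  have h1 : ∀ h' : List M, (if h.IsRotated h' then (rotFix h' : ℝ≥0∞) else 0) =
      ∑ r ∈ Finset.range h.length, if h' = h.rotate r then 1 else 0 := fun h' => by
    split_ifs with hr
    · rw [rotFix_eq_card hr, ← Finset.sum_filter, Finset.sum_const, nsmul_one]
      simp only [eq_comm]
    · refine (Finset.sum_eq_zero fun r _ => if_neg ?_).symm
      rintro rfl
      exact hr ⟨r, rfl⟩
  simp only [h1]
  rw [Summable.tsum_finsetSum fun _ _ => ENNReal.summable]
  simp

-- Shifts are grouped by their gcd `l` with the length: whether a shift fixes `h` depends only on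
-- `l`, and `φ(length / l)` shifts have gcd `l`.
open Classical in
theorem rotFix_eq_tsum (h : List M) :
    (rotFix h : ℝ≥0∞) = ∑' l : ℕ+, if (l : ℕ) ∣ h.length ∧ h.rotate l = h then
      (Nat.totient (h.length / l) : ℝ≥0∞) else 0 := by
  rw [rotFix, ← nsmul_one, ← Finset.sum_const, Finset.sum_filter]
  have h1 : ∀ r ∈ Finset.range h.length, (if h.rotate r = h then (1 : ℝ≥0∞) else 0) =
      ∑' l : ℕ+, if h.length.gcd r = l ∧ h.rotate l = h then 1 else 0 := fun r hr => by
    have hpos : 0 < h.length.gcd r := Nat.gcd_pos_of_pos_left _ (by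
      rw [Finset.mem_range] at hr; omega)
    rw [tsum_eq_single ⟨_, hpos⟩]
    · simp only [PNat.mk_coe, true_and]
      rw [if_congr (rotate_eq_self_iff_gcd r) rfl rfl]
    · intro l hl
      rw [if_neg]
      rintro ⟨he, _⟩
      exact hl (PNat.eq he.symm)
  rw [Finset.sum_congr rfl h1, ← Summable.tsum_finsetSum fun _ _ => ENNReal.summable]
  refine tsum_congr fun l => ?_
  by_cases hr : h.rotate l = h
  · simp only [hr, and_true]
    rw [← Finset.sum_filter, Finset.sum_const, nsmul_one]
    split_ifs with hd
    · rw [Nat.totient_div_of_dvd hd]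
    · rw [Finset.filter_false_of_mem, Finset.card_empty, Nat.cast_zero]
      rintro r _ he
      exact hd (he ▸ Nat.gcd_dvd_left _ _)
  · simp [hr]

-- A list has at most one `k`-th root of length `l`, namely its first `l` entries.
open Classical in
theorem tsum_flatten_replicate_eq (h : List M) (k l : ℕ+) :
    ∑' L : List M, (if L.length = l ∧ h = (List.replicate k L).flatten then (1 : ℝ≥0∞) else 0) =
      if h.length = k * l ∧ h.rotate l = h then 1 else 0 := by
  split_ifs with hh
  · have he := eq_flatten_replicate l.pos hh.1 hh.2
    have hlh : (h.take l).length = l := by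
      simpa [hh.1] using Nat.le_mul_of_pos_left (l : ℕ) k.pos
    rw [tsum_eq_single (h.take l), if_pos ⟨hlh, he⟩]
    rintro L hL
    rw [if_neg]
    rintro ⟨h1, h2⟩
    apply hL
    obtain ⟨k', hk'⟩ := Nat.exists_eq_succ_of_ne_zero k.pos.ne'
    rw [h2, ← h1, hk', List.replicate_succ, List.flatten_cons, List.take_left]
  · refine ENNReal.tsum_eq_zero.2 fun L => if_neg ?_
    rintro ⟨h1, rfl⟩
    exact hh ⟨by rw [length_flatten_replicate, h1], h1 ▸ rotate_flatten_replicate k L⟩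

/-- Burnside's lemma for cycles: every nonempty cycle arises with total weight `1` from repeating
a sequence of length `l` a number `k` of times, with weight `φ(k) / (k l)`. -/
theorem tsum_cycle (G : Cycle M → ℝ≥0∞) :
    ∑' k : ℕ+, ∑' l : ℕ+, (Nat.totient k : ℝ≥0∞) / (k : ℕ) * ((l : ℕ) : ℝ≥0∞)⁻¹ *
      (∑' L : List M, if L.length = l then G ((List.replicate k L).flatten : List M) else 0) =
      ∑' c : {c : Cycle M // c ≠ Cycle.nil}, G c.1 := by
  classical
  -- The value at a cycle is spread over the lists representing it, with weights `rotFix h /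
  -- h.length`; these add up to `1` by `tsum_rotFix`.
  have h1 : ∀ c : {c : Cycle M // c ≠ Cycle.nil}, G c.1 =
      ∑' h : List M, if (h : Cycle M) = c.1 then G h * rotFix h / h.length else 0 := by
    rintro ⟨c, hc⟩
    induction c using Quot.induction_on with
    | _ h0 =>
      have hh0 : h0 ≠ [] := fun h => hc (by rw [h]; rfl)
      have h2 : ∀ h : List M, (if (h : Cycle M) = (h0 : Cycle M) then
          G h * rotFix h / h.length else 0) = G h0 * (h0.length : ℝ≥0∞)⁻¹ *
            (if h0.IsRotated h then (rotFix h : ℝ≥0∞) else 0) := fun h => by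
        rw [if_congr (Cycle.coe_eq_coe.trans List.isRotated_comm) rfl rfl]
        split_ifs with hr
        · rw [← (Cycle.coe_eq_coe.2 hr), hr.perm.length_eq, div_eq_mul_inv]
          ring
        · simp
      have hl0 : (h0.length : ℝ≥0∞) ≠ 0 := by simpa using hh0
      change G (h0 : Cycle M) = ∑' h : List M, if (h : Cycle M) = (h0 : Cycle M) then
          G h * rotFix h / h.length else 0
      simp only [h2]
      rw [ENNReal.tsum_mul_left, tsum_rotFix, mul_assoc,
        ENNReal.inv_mul_cancel hl0 (ENNReal.natCast_ne_top _), mul_one]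
  have h3 : ∀ h : List M, (∑' c : {c : Cycle M // c ≠ Cycle.nil},
      if (h : Cycle M) = c.1 then G h * rotFix h / h.length else 0) =
        G h * rotFix h / h.length := fun h => by
    -- The empty list represents no admissible cycle, but it has `rotFix = 0` and contributes
    -- nothing.
    rcases eq_or_ne h [] with rfl | hh
    · simp [rotFix]
    · have hc : (h : Cycle M) ≠ Cycle.nil := fun hc => hh ((Cycle.coe_eq_nil h).1 hc)
      rw [tsum_eq_single ⟨(h : Cycle M), hc⟩, if_pos rfl]
      rintro ⟨c, hc'⟩ hne
      exact if_neg fun he => hne (Subtype.ext he.symm)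
  have h5 : ∑' c : {c : Cycle M // c ≠ Cycle.nil}, G c.1 =
      ∑' h : List M, G h * rotFix h / h.length := by
    simp only [h1]
    rw [ENNReal.tsum_comm]
    exact tsum_congr h3
  rw [h5]
  have h4 : ∀ (k l : ℕ+), (∑' L : List M, if L.length = l then
      G ((List.replicate k L).flatten : List M) else 0) =
      ∑' h : List M, G h * if h.length = k * l ∧ h.rotate l = h then 1 else 0 := fun k l => by
    simp only [← tsum_flatten_replicate_eq, ← ENNReal.tsum_mul_left]
    rw [ENNReal.tsum_comm]
    refine tsum_congr fun L => ?_
    rw [tsum_eq_single (List.replicate k L).flatten]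
    · simp
    · intro h hne
      rw [if_neg fun hh => hne hh.2, mul_zero]
  simp only [h4, ← ENNReal.tsum_mul_left]
  rw [ENNReal.tsum_comm]
  refine ((tsum_congr fun l => ENNReal.tsum_comm).trans ENNReal.tsum_comm).trans ?_
  refine tsum_congr fun h => ?_
  rw [rotFix_eq_tsum, div_eq_mul_inv, mul_assoc, ← ENNReal.tsum_mul_right, ← ENNReal.tsum_mul_left]
  -- For fixed `h` and `l` only `k = h.length / l` survives, and then `φ(k) / (k l) = φ(h.length /
  -- l) / h.length`.
  refine tsum_congr fun l => ?_
  by_cases hd : (l : ℕ) ∣ h.length ∧ h.rotate l = h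
  swap
  · rw [if_neg hd, zero_mul, mul_zero]
    refine ENNReal.tsum_eq_zero.2 fun k => ?_
    rw [if_neg, mul_zero, mul_zero]
    exact fun hh => hd ⟨hh.1 ▸ dvd_mul_left _ _, hh.2⟩
  rw [if_pos hd]
  rcases Nat.eq_zero_or_pos h.length with h0 | hpos
  · rw [h0]
    simp
  obtain ⟨k, hk⟩ := hd.1
  have hkpos : 0 < k := Nat.pos_of_ne_zero fun hk0 => by rw [hk0, mul_zero] at hk; omega
  rw [tsum_eq_single ⟨k, hkpos⟩]
  · rw [PNat.mk_coe, if_pos ⟨by rw [hk, mul_comm], hd.2⟩, hk, Nat.mul_div_cancel_left _ l.pos,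
      Nat.cast_mul, ENNReal.mul_inv (Or.inr (ENNReal.natCast_ne_top _))
        (Or.inl (ENNReal.natCast_ne_top _)), div_eq_mul_inv]
    ring
  · intro k' hk'
    rw [if_neg, mul_zero, mul_zero]
    rintro ⟨hh, _⟩
    apply hk'
    apply PNat.eq
    rw [hk, mul_comm] at hh
    exact (Nat.eq_of_mul_eq_mul_right l.pos hh).symm

end Cycles

/-! ## Weights of members -/

section Members

variable {ι : Type u} {spec : ι → ClassExpr ι} {B : Type} {a b : ClassExpr ι}

/-- The weight `x ^ size` of a representative, replaced by `0` if named classes are nested more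
than `n` deep. -/
def Rep.wt (x : ℝ≥0∞) : {a : ClassExpr ι} → Rep spec B a → ℕ∞ → ℝ≥0∞
  | _, .neutral _, _ => 1
  | _, .atom _, _ => x
  | _, .name _ d, n => if n = 0 then 0 else d.wt x (n - 1)
  | _, .inl d, n => d.wt x n
  | _, .inr d, n => d.wt x n
  | _, .pair d d', n => d.wt x n * d'.wt x n
  | _, .seq _ f, n => ∏ i, (f i).wt x n
  | _, .diag k d, n => d.wt x n ^ (k : ℕ)
  | _, .mset _ f, n => ∏ i, (f i).wt x n
  | _, .cyc _ _ f, n => ∏ i, (f i).wt x n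

theorem Rep.Equiv.wt_eq {x : ℝ≥0∞} {d e : Rep spec B a} (h : Rep.Equiv d e) (n : ℕ∞) :
    d.wt x n = e.wt x n := by
  induction h generalizing n with
  | neutral w => rfl
  | atom b => rfl
  | name i _ ih => simp only [Rep.wt, ih]
  | inl _ ih => exact ih n
  | inr _ ih => exact ih n
  | pair _ _ ih ih' => simp only [Rep.wt, ih, ih']
  | seq _ ih => simp only [Rep.wt, ih]
  | diag k _ ih => simp only [Rep.wt, ih]
  | mset σ _ ih =>
    simp only [Rep.wt, ih]
    exact Equiv.prod_comp σ fun i => Rep.wt x _ n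
  | cyc σ hσ _ ih =>
    simp only [Rep.wt, ih]
    exact Equiv.prod_comp σ fun i => Rep.wt x _ n

/-- This is how dilated parameters become powers of weights. The exponent must be nonzero so that a
truncated weight `0` stays `0`. -/
theorem Rep.wt_pow (x : ℝ≥0∞) {k : ℕ} (hk : k ≠ 0) (d : Rep spec B a) (n : ℕ∞) :
    d.wt (x ^ k) n = d.wt x n ^ k := by
  induction d generalizing n with
  | neutral w => simp [Rep.wt]
  | atom b => rfl
  | name i _ ih =>
    simp only [Rep.wt, ih]
    split_ifs
    · rw [zero_pow hk]
    · rfl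
  | inl _ ih => exact ih n
  | inr _ ih => exact ih n
  | pair _ _ ih ih' => simp only [Rep.wt, ih, ih', mul_pow]
  | seq _ _ ih => simp only [Rep.wt, ih, Finset.prod_pow]
  | diag k _ ih => simp only [Rep.wt, ih, pow_right_comm]
  | mset _ _ ih => simp only [Rep.wt, ih, Finset.prod_pow]
  | cyc _ _ _ ih => simp only [Rep.wt, ih, Finset.prod_pow]

theorem Rep.wt_top (x : ℝ≥0∞) (d : Rep spec B a) : d.wt x ⊤ = x ^ d.word.size := by
  induction d with
  | neutral w => simp [Rep.wt, Rep.word, Word.size_map, Word.size_empty]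
  | atom b => simp [Rep.wt, Rep.word, Word.size]
  | name i _ ih => simpa [Rep.wt, Rep.word] using ih
  | inl _ ih => exact ih
  | inr _ ih => exact ih
  | pair _ _ ih ih' => simp [Rep.wt, Rep.word, Word.size, ih, ih', pow_add]
  | seq _ _ ih => simp [Rep.wt, Rep.word, Word.size, ih, Finset.prod_pow_eq_pow_sum]
  | diag k _ ih => simp [Rep.wt, Rep.word, Word.size, ih, pow_mul, pow_right_comm]
  | mset _ _ ih => simp [Rep.wt, Rep.word, Word.size, ih, Finset.prod_pow_eq_pow_sum]
  | cyc _ _ _ ih => simp [Rep.wt, Rep.word, Word.size, ih, Finset.prod_pow_eq_pow_sum]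

theorem Rep.wt_mono (x : ℝ≥0∞) (d : Rep spec B a) : Monotone (d.wt x) := by
  induction d with
  | neutral w => exact fun _ _ _ => le_rfl
  | atom b => exact fun _ _ _ => le_rfl
  | name i _ ih =>
    intro m n h
    simp only [Rep.wt]
    rcases eq_or_ne m 0 with h1 | h1
    · simp [h1]
    · have h2 : n ≠ 0 := fun h2 => h1 (le_antisymm (h2 ▸ h) zero_le)
      rw [if_neg h1, if_neg h2]
      exact ih (tsub_le_tsub_right h 1)
  | inl _ ih => exact ih
  | inr _ ih => exact ih
  | pair _ _ ih ih' => exact fun m n h => mul_le_mul' (ih h) (ih' h)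
  | seq _ _ ih => exact fun m n h => Finset.prod_le_prod' fun i _ => ih i h
  | diag k _ ih => exact fun m n h => pow_le_pow_left' (ih h) _
  | mset _ _ ih => exact fun m n h => Finset.prod_le_prod' fun i _ => ih i h
  | cyc _ _ _ ih => exact fun m n h => Finset.prod_le_prod' fun i _ => ih i h

theorem enat_succ_sub_one (n : ℕ) : ((n + 1 : ℕ) : ℕ∞) - 1 = n := by
  exact_mod_cast (ENat.natCast_sub (n + 1) 1).symm

theorem exists_nat_forall_fin {n : ℕ} {p : Fin n → ℕ → Prop}
    (h : ∀ i, ∃ N, ∀ m ≥ N, p i m) : ∃ N, ∀ m ≥ N, ∀ i, p i m := by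
  choose N hN using h
  exact ⟨Finset.univ.sup N, fun m hm i =>
    hN i m ((Finset.le_sup (f := N) (Finset.mem_univ i)).trans hm)⟩

/-- A representative is a well-founded tree with finite branching, so its nesting of named classes
is bounded and a deep enough truncation does not affect it. -/
theorem Rep.exists_wt_eq (x : ℝ≥0∞) (d : Rep spec B a) :
    ∃ N : ℕ, ∀ n : ℕ, n ≥ N → d.wt x n = d.wt x ⊤ := by
  induction d with
  | neutral w => exact ⟨0, fun _ _ => rfl⟩
  | atom b => exact ⟨0, fun _ _ => rfl⟩
  | name i _ ih =>
    obtain ⟨N, hN⟩ := ih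
    refine ⟨N + 1, fun n hn => ?_⟩
    obtain ⟨n, rfl⟩ := Nat.exists_eq_add_of_le' (show 1 ≤ n by omega)
    rw [Rep.wt, Rep.wt, if_neg (by simp), if_neg (by simp), enat_succ_sub_one]
    exact hN n (by omega)
  | inl _ ih => exact ih
  | inr _ ih => exact ih
  | pair _ _ ih ih' =>
    obtain ⟨N, hN⟩ := ih
    obtain ⟨N', hN'⟩ := ih'
    exact ⟨max N N', fun n hn => congrArg₂ (· * ·) (hN n (le_of_max_le_left hn))
      (hN' n (le_of_max_le_right hn))⟩
  | seq _ _ ih =>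
    obtain ⟨N, hN⟩ := exists_nat_forall_fin ih
    exact ⟨N, fun n hn => Finset.prod_congr rfl fun i _ => hN n hn i⟩
  | diag k _ ih =>
    obtain ⟨N, hN⟩ := ih
    exact ⟨N, fun n hn => congrArg (· ^ (k : ℕ)) (hN n hn)⟩
  | mset _ _ ih =>
    obtain ⟨N, hN⟩ := exists_nat_forall_fin ih
    exact ⟨N, fun n hn => Finset.prod_congr rfl fun i _ => hN n hn i⟩
  | cyc _ _ _ ih =>
    obtain ⟨N, hN⟩ := exists_nat_forall_fin ih
    exact ⟨N, fun n hn => Finset.prod_congr rfl fun i _ => hN n hn i⟩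

/-- The member given by a representative. -/
def Member.mk (d : Rep spec B a) : Member spec B a := Quotient.mk _ d

theorem Member.mk_eq_mk {d e : Rep spec B a} : Member.mk d = Member.mk e ↔ Rep.Equiv d e :=
  Quotient.eq

theorem Member.mk_out (m : Member spec B a) : Member.mk m.out = m := Quotient.out_eq m

theorem Member.ind {p : Member spec B a → Prop} (h : ∀ d, p (.mk d)) (m : Member spec B a) : p m :=
  Quotient.ind h m

/-- The weight of a member. -/
def Member.wt (x : ℝ≥0∞) (n : ℕ∞) : Member spec B a → ℝ≥0∞ :=
  Quotient.lift (fun d => d.wt x n) fun _ _ h => Rep.Equiv.wt_eq h n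

theorem Member.wt_mk (x : ℝ≥0∞) (n : ℕ∞) (d : Rep spec B a) : (Member.mk d).wt x n = d.wt x n := rfl

theorem Member.obj_mk (d : Rep spec B a) : (Member.mk d).obj = Obj.mk d.word := rfl

theorem Member.wt_pow (x : ℝ≥0∞) {k : ℕ} (hk : k ≠ 0) (n : ℕ∞) (m : Member spec B a) :
    m.wt (x ^ k) n = m.wt x n ^ k := by
  induction m using Member.ind with | _ d => exact d.wt_pow x hk n

theorem Member.wt_top (x : ℝ≥0∞) (m : Member spec B a) : m.wt x ⊤ = x ^ m.obj.size := by
  induction m using Member.ind with | _ d => exact d.wt_top x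

theorem Member.wt_mono (x : ℝ≥0∞) (m : Member spec B a) : Monotone fun n => m.wt x n := by
  induction m using Member.ind with | _ d => exact d.wt_mono x

theorem Member.iSup_wt (x : ℝ≥0∞) (m : Member spec B a) : ⨆ n : ℕ, m.wt x n = m.wt x ⊤ := by
  refine le_antisymm (iSup_le fun n => m.wt_mono x le_top) ?_
  induction m using Member.ind with
  | _ d =>
    obtain ⟨N, hN⟩ := d.exists_wt_eq x
    exact le_iSup_of_le N (hN N le_rfl).ge

/-! ## Sums over members -/

variable (x : ℝ≥0∞) (n : ℕ∞) (φ : Obj B → ℝ≥0∞)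

theorem tsum_eq_of_bijective {M N : Type*} {e : M → N} (he : Function.Bijective e)
    {f : M → ℝ≥0∞} {g : N → ℝ≥0∞} (h : ∀ m, f m = g (e m)) : ∑' m, f m = ∑' l, g l := by
  rw [← (Equiv.ofBijective e he).tsum_eq]
  exact tsum_congr h

/-- This and its analogues for the other builders rewrite a sum over members in terms of the
components. The equivalence of representatives is generated builder by builder, so the map to the
components is a bijection on classes. -/
theorem tsum_member_neutral (w : Word Empty) :
    ∑' m : Member spec B (.neutral w), m.wt x n * φ m.obj = φ (Obj.mk (w.map Empty.elim)) := by
  have key : ∀ m : Member spec B (.neutral w), m = .mk (.neutral w) := fun m => by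
    induction m using Member.ind with | _ d => cases d; rfl
  rw [tsum_eq_single (.mk (.neutral w)) fun m hm => absurd (key m) hm, Member.wt_mk,
    Member.obj_mk, Rep.wt, one_mul, Rep.word]

theorem tsum_member_atom [Fintype B] :
    ∑' m : Member spec B .atom, m.wt x n * φ m.obj = x * ∑ b, φ (Obj.mk (.atom b)) := by
  rw [← tsum_fintype (L := .unconditional _), ← ENNReal.tsum_mul_left]
  refine (tsum_eq_of_bijective (e := fun b => Member.mk (Rep.atom b)) ⟨?_, ?_⟩
    fun b => rfl).symm
  · intro b b' h
    cases Member.mk_eq_mk.1 h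
    rfl
  · intro m
    induction m using Member.ind with | _ d => cases d with | atom b => exact ⟨b, rfl⟩

theorem tsum_member_name (i : ι) : ∑' m : Member spec B (.name i), m.wt x n * φ m.obj =
    if n = 0 then 0 else ∑' m : Member spec B (spec i), m.wt x (n - 1) * φ m.obj := by
  let e : Member spec B (spec i) → Member spec B (.name i) :=
    Quotient.lift (fun d => Member.mk (.name i d)) fun d d' h => Member.mk_eq_mk.2 (.name i h)
  have he : Function.Bijective e := by
    constructor
    · intro m m' h
      induction m using Member.ind with | _ d =>
      induction m' using Member.ind with | _ d' =>
      cases Member.mk_eq_mk.1 h with | name _ h => exact Member.mk_eq_mk.2 h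
    · intro m
      induction m using Member.ind with | _ d => cases d with | name i d => exact ⟨.mk d, rfl⟩
  split_ifs with hn
  · refine ENNReal.tsum_eq_zero.2 fun m => ?_
    induction m using Member.ind with | _ d =>
    cases d with | name i d => rw [Member.wt_mk, Rep.wt, if_pos hn, zero_mul]
  · refine (tsum_eq_of_bijective he fun m => ?_).symm
    induction m using Member.ind with | _ d =>
    change _ = (Member.mk (.name i d)).wt x n * φ (Member.mk (.name i d)).obj
    rw [Member.wt_mk, Member.wt_mk, Rep.wt, if_neg hn]
    rfl

theorem tsum_member_sum : ∑' m : Member spec B (.sum a b), m.wt x n * φ m.obj =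
    ∑' m : Member spec B a, m.wt x n * φ m.obj + ∑' m : Member spec B b, m.wt x n * φ m.obj := by
  let e : Member spec B a ⊕ Member spec B b → Member spec B (.sum a b) := Sum.elim
    (Quotient.lift (fun d => Member.mk (.inl d)) fun d d' h => Member.mk_eq_mk.2 (.inl h))
    (Quotient.lift (fun d => Member.mk (.inr d)) fun d d' h => Member.mk_eq_mk.2 (.inr h))
  have he : Function.Bijective e := by
    constructor
    · rintro (m | m) (m' | m') h <;> induction m using Member.ind with | _ d <;>
        induction m' using Member.ind with | _ d'
      · cases Member.mk_eq_mk.1 h with | inl h => exact congrArg Sum.inl (Member.mk_eq_mk.2 h)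
      · cases Member.mk_eq_mk.1 h
      · cases Member.mk_eq_mk.1 h
      · cases Member.mk_eq_mk.1 h with | inr h => exact congrArg Sum.inr (Member.mk_eq_mk.2 h)
    · intro m
      induction m using Member.ind with | _ d =>
      cases d with
      | inl d => exact ⟨.inl (.mk d), rfl⟩
      | inr d => exact ⟨.inr (.mk d), rfl⟩
  rw [← tsum_eq_of_bijective (f := Sum.elim (fun m : Member spec B a => m.wt x n * φ m.obj)
    fun m : Member spec B b => m.wt x n * φ m.obj) he]
  · exact ENNReal.summable.tsum_sum ENNReal.summable
  · rintro (m | m) <;> induction m using Member.ind <;> rfl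

theorem tsum_member_prod : ∑' m : Member spec B (.prod a b), m.wt x n * φ m.obj =
    ∑' m : Member spec B a, ∑' m' : Member spec B b,
      m.wt x n * (m'.wt x n * φ (Obj.node .seq [m.obj, m'.obj])) := by
  let e : Member spec B a × Member spec B b → Member spec B (.prod a b) := fun p =>
    Quotient.lift₂ (fun d d' => Member.mk (.pair d d'))
      (fun _ _ _ _ h h' => Member.mk_eq_mk.2 (.pair h h')) p.1 p.2
  have he : Function.Bijective e := by
    constructor
    · rintro ⟨m, l⟩ ⟨m', l'⟩ h
      induction m using Member.ind with | _ d =>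
      induction m' using Member.ind with | _ d' =>
      induction l using Member.ind with | _ c =>
      induction l' using Member.ind with | _ c' =>
      cases Member.mk_eq_mk.1 h with
      | pair h h' => exact Prod.ext (Member.mk_eq_mk.2 h) (Member.mk_eq_mk.2 h')
    · intro m
      induction m using Member.ind with | _ d =>
      cases d with | pair d d' => exact ⟨(.mk d, .mk d'), rfl⟩
  rw [← ENNReal.tsum_prod]
  refine (tsum_eq_of_bijective he ?_).symm
  rintro ⟨m, m'⟩
  induction m using Member.ind with | _ d =>
  induction m' using Member.ind with | _ d' =>
  change _ = (Member.mk (.pair d d')).wt x n * φ (Member.mk (.pair d d')).obj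
  simp [Member.wt_mk, Member.obj_mk, Rep.wt, Rep.word, Obj.mk_node, mul_assoc]

theorem tsum_member_diag (k : ℕ+) : ∑' m : Member spec B (.diag k a), m.wt x n * φ m.obj =
    ∑' m : Member spec B a, m.wt x n ^ (k : ℕ) * φ (Obj.node .seq (List.replicate k m.obj)) := by
  let e : Member spec B a → Member spec B (.diag k a) :=
    Quotient.lift (fun d => Member.mk (.diag k d)) fun d d' h => Member.mk_eq_mk.2 (.diag k h)
  have he : Function.Bijective e := by
    constructor
    · intro m m' h
      induction m using Member.ind with | _ d =>
      induction m' using Member.ind with | _ d' =>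
      cases Member.mk_eq_mk.1 h with | diag _ h => exact Member.mk_eq_mk.2 h
    · intro m
      induction m using Member.ind with | _ d => cases d with | diag _ d => exact ⟨.mk d, rfl⟩
  refine (tsum_eq_of_bijective he fun m => ?_).symm
  induction m using Member.ind with | _ d =>
  change _ = (Member.mk (.diag k d)).wt x n * φ (Member.mk (.diag k d)).obj
  simp [Member.wt_mk, Member.obj_mk, Rep.wt, Rep.word, Obj.mk_node]

/-- The list of members given by a tuple of representatives. -/
def memberList {k : ℕ} (f : Fin k → Rep spec B a) : List (Member spec B a) :=
  List.ofFn fun i => Member.mk (f i)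

theorem exists_memberList (l : List (Member spec B a)) :
    ∃ f : Fin l.length → Rep spec B a, memberList f = l :=
  ⟨fun i => (l.get i).out, by simp [memberList, Member.mk_out]⟩

theorem memberList_eq_iff {k l : ℕ} {f : Fin k → Rep spec B a} {g : Fin l → Rep spec B a} :
    memberList f = memberList g ↔
      ∃ h : k = l, ∀ i, Rep.Equiv (f i) (g (i.cast h)) := by
  constructor
  · intro h
    obtain rfl : k = l := by simpa [memberList] using congrArg List.length h
    refine ⟨rfl, fun i => Member.mk_eq_mk.1 (congrFun (List.ofFn_injective h) i)⟩
  · rintro ⟨rfl, h⟩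
    exact congrArg List.ofFn (funext fun i => Member.mk_eq_mk.2 (h i))

theorem prod_map_memberList {k : ℕ} (f : Fin k → Rep spec B a) :
    ((memberList f).map (Member.wt x n)).prod = ∏ i, (f i).wt x n := by
  rw [memberList, List.map_ofFn, List.prod_ofFn]
  rfl

theorem map_obj_memberList {k : ℕ} (f : Fin k → Rep spec B a) :
    (memberList f).map Member.obj = List.ofFn fun i => Obj.mk (f i).word := by
  rw [memberList, List.map_ofFn]
  rfl

theorem tsum_member_seq : ∑' m : Member spec B (.seq a), m.wt x n * φ m.obj =
    ∑' l : List (Member spec B a), (l.map (Member.wt x n)).prod *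
      φ (Obj.node .seq (l.map Member.obj)) := by
  let e' : Rep spec B (.seq a) → List (Member spec B a) := fun | .seq _ f => memberList f
  let e : Member spec B (.seq a) → List (Member spec B a) := Quotient.lift e' fun d d' h => by
    cases h with | seq h => exact memberList_eq_iff.2 ⟨rfl, h⟩
  have he : Function.Bijective e := by
    constructor
    · intro m m' h
      induction m using Member.ind with | _ d =>
      induction m' using Member.ind with | _ d' =>
      cases d with | seq k f =>
      cases d' with | seq l g =>
      obtain ⟨rfl, h⟩ := memberList_eq_iff.1 h
      exact Member.mk_eq_mk.2 (.seq h)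
    · intro l
      obtain ⟨f, hf⟩ := exists_memberList l
      exact ⟨.mk (.seq _ f), hf⟩
  refine tsum_eq_of_bijective he fun m => ?_
  induction m using Member.ind with | _ d =>
  cases d with | seq k f =>
  change _ = ((memberList f).map _).prod * φ (Obj.node .seq ((memberList f).map _))
  rw [prod_map_memberList, map_obj_memberList, ← Obj.mk_node]
  rfl

theorem tsum_member_mset : ∑' m : Member spec B (.mset a), m.wt x n * φ m.obj =
    ∑' l : Multiset (Member spec B a), (l.map (Member.wt x n)).prod *
      φ (Obj.mset (l.map Member.obj)) := by
  let e' : Rep spec B (.mset a) → Multiset (Member spec B a) := fun | .mset _ f => memberList f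
  let e : Member spec B (.mset a) → Multiset (Member spec B a) := Quotient.lift e' fun d d' h => by
    cases h with
    | @mset _ k f g σ h =>
      refine Multiset.coe_eq_coe.2 ?_
      have : memberList f = List.ofFn ((fun i => Member.mk (g i)) ∘ σ) :=
        congrArg List.ofFn (funext fun i => Member.mk_eq_mk.2 (h i))
      rw [this]
      exact σ.ofFn_comp_perm _
  have he : Function.Bijective e := by
    constructor
    · intro m m' h
      induction m using Member.ind with | _ d =>
      induction m' using Member.ind with | _ d' =>
      cases d with | mset k f =>
      cases d' with | mset l g =>
      have h : (memberList f).Perm (memberList g) := Multiset.coe_eq_coe.1 h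
      obtain rfl : k = l := by simpa [memberList] using h.length_eq
      obtain ⟨σ, hσ⟩ := exists_perm_of_ofFn_perm h
      exact Member.mk_eq_mk.2 (.mset σ fun i => Member.mk_eq_mk.1 (hσ i))
    · intro l
      induction l using Quotient.ind with | _ l =>
      obtain ⟨f, hf⟩ := exists_memberList l
      exact ⟨.mk (.mset _ f), congrArg _ hf⟩
  refine tsum_eq_of_bijective he fun m => ?_
  induction m using Member.ind with | _ d =>
  cases d with | mset k f =>
  change _ = ((memberList f : Multiset (Member spec B a)).map _).prod *
    φ (Obj.mset ((memberList f : Multiset (Member spec B a)).map _))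
  rw [Multiset.map_coe, Multiset.map_coe, Multiset.prod_coe, prod_map_memberList,
    map_obj_memberList]
  change _ = _ * φ (Obj.node .mset _)
  rw [← Obj.mk_node]
  rfl

theorem tsum_member_cyc : ∑' m : Member spec B (.cyc a), m.wt x n * φ m.obj =
    ∑' l : {l : Cycle (Member spec B a) // l ≠ Cycle.nil},
      (l.1.toMultiset.map (Member.wt x n)).prod * φ (Obj.cyc (l.1.map Member.obj)) := by
  have hne : ∀ {k : ℕ} (f : Fin k → Rep spec B a), 0 < k →
      (memberList f : Cycle (Member spec B a)) ≠ Cycle.nil := fun f hk h => by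
    have := congrArg List.length ((Cycle.coe_eq_nil _).1 h)
    simp [memberList] at this
    omega
  let e' : Rep spec B (.cyc a) → {l : Cycle (Member spec B a) // l ≠ Cycle.nil} :=
    fun | .cyc _ hk f => ⟨memberList f, hne f hk⟩
  let e : Member spec B (.cyc a) → {l : Cycle (Member spec B a) // l ≠ Cycle.nil} :=
    Quotient.lift e' fun d d' h => by
      cases h with
      | @cyc _ k _ f g σ hσ h =>
        refine Subtype.ext (Cycle.coe_eq_coe.2 ?_)
        -- In a finite group integer powers are natural powers, as `List.rotate` requires.
        obtain ⟨s, hs⟩ : ∃ s : ℕ, finRotate k ^ s = σ :=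
          mem_powers_iff_mem_zpowers.2 hσ
        have : memberList f = List.ofFn (fun i => Member.mk (g ((finRotate k ^ s) i))) :=
          congrArg List.ofFn (funext fun i => Member.mk_eq_mk.2 (hs ▸ h i))
        rw [this, ofFn_finRotate_pow fun i => Member.mk (g i)]
        exact List.IsRotated.symm ⟨s, rfl⟩
  have he : Function.Bijective e := by
    constructor
    · intro m m' h
      induction m using Member.ind with | _ d =>
      induction m' using Member.ind with | _ d' =>
      cases d with | cyc k hk f =>
      cases d' with | cyc l hl g =>
      have h : (memberList g).IsRotated (memberList f) :=
        (Cycle.coe_eq_coe.1 (congrArg Subtype.val h)).symm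
      obtain rfl : k = l := by simpa [memberList] using h.perm.length_eq.symm
      obtain ⟨s, hs⟩ := h
      rw [memberList, ← ofFn_finRotate_pow] at hs
      refine Member.mk_eq_mk.2 (.cyc (finRotate k ^ s) ⟨s, by simp⟩ fun i => ?_)
      exact Member.mk_eq_mk.1 (congrFun (List.ofFn_injective hs) i).symm
    · rintro ⟨l, hl⟩
      induction l using Quot.ind with | _ l =>
      obtain ⟨f, hf⟩ := exists_memberList l
      refine ⟨.mk (.cyc _ (List.length_pos_iff.2 fun h => hl (by rw [h]; rfl)) f), ?_⟩
      exact Subtype.ext (congrArg (Cycle.ofList (α := Member spec B a)) hf)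
  refine tsum_eq_of_bijective he fun m => ?_
  induction m using Member.ind with | _ d =>
  cases d with | cyc k hk f =>
  change _ = ((memberList f : Cycle (Member spec B a)).toMultiset.map _).prod *
    φ (Obj.node .cyc ((memberList f).map _))
  rw [Cycle.coe_toMultiset, Multiset.map_coe, Multiset.prod_coe, prod_map_memberList,
    map_obj_memberList, ← Obj.mk_node]
  rfl

end Members

/-! ## Exponentials and logarithms in `[0, ∞]` -/

theorem expPos_zero : expPos 0 = 1 := by simp [expPos]

theorem expPos_add (y z : ℝ≥0∞) : expPos (y + z) = expPos y * expPos z := by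
  rw [expPos, EReal.coe_ennreal_add, EReal.exp_add, expPos, expPos]

theorem expNeg_eq_inv (y : ℝ≥0∞) : expNeg y = (expPos y)⁻¹ := by
  rw [expNeg, EReal.exp_neg, expPos]

theorem expPos_ne_zero (y : ℝ≥0∞) : expPos y ≠ 0 := by
  rw [expPos, Ne, EReal.exp_eq_zero_iff]
  exact EReal.coe_ennreal_ne_bot y

theorem expPos_eq_top_iff {y : ℝ≥0∞} : expPos y = ⊤ ↔ y = ⊤ := by
  rw [expPos, EReal.exp_eq_top_iff, EReal.coe_ennreal_eq_top_iff]

theorem expPos_monotone : Monotone expPos := fun _ _ h =>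
  EReal.exp_monotone (EReal.coe_ennreal_strictMono.monotone h)

theorem one_le_expPos (y : ℝ≥0∞) : 1 ≤ expPos y := by
  simpa [expPos_zero] using expPos_monotone (zero_le (a := y))

theorem expPos_eq_one_iff {y : ℝ≥0∞} : expPos y = 1 ↔ y = 0 := by
  refine ⟨fun h => ?_, fun h => h ▸ expPos_zero⟩
  rw [expPos, ← EReal.exp_zero] at h
  simpa using EReal.exp_strictMono.injective h

theorem expPos_iSup (y : ℕ → ℝ≥0∞) : expPos (⨆ n, y n) = ⨆ n, expPos (y n) :=
  Monotone.map_ciSup_of_continuousAt (f := expPos)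
    (ENNReal.continuous_exp.comp continuous_coe_ennreal_ereal).continuousAt expPos_monotone (OrderTop.bddAbove _)

theorem expPos_eq_tsum (y : ℝ≥0∞) : expPos y = ∑' q : ℕ, y ^ q / (q.factorial : ℝ≥0∞) := by
  induction y with
  | top =>
    rw [expPos_eq_top_iff.2 rfl]
    -- The term `q = 1` is already infinite.
    exact (ENNReal.tsum_eq_top_of_eq_top ⟨1, by simp⟩).symm
  | coe y =>
    have h := NormedSpace.expSeries_div_hasSum_exp (y : ℝ)
    rw [expPos, EReal.coe_nnreal_eq_coe_real, EReal.exp_coe, Real.exp_eq_exp_ℝ, ← h.tsum_eq,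
      ENNReal.ofReal_tsum_of_nonneg (fun q => by positivity) h.summable]
    refine tsum_congr fun q => ?_
    rw [ENNReal.ofReal_div_of_pos (by positivity), ENNReal.ofReal_pow y.coe_nonneg,
      ENNReal.ofReal_coe_nnreal, ENNReal.ofReal_natCast]

theorem tsum_pnat_eq_tsum_succPNat (f : ℕ+ → ℝ≥0∞) : ∑' k, f k = ∑' n : ℕ, f n.succPNat :=
  (Equiv.pnatEquivNat.symm.tsum_eq f).symm

/-- Below `1` this is the Taylor series of the logarithm; from `1` on the series dominates the
harmonic series and both sides are infinite. -/
theorem negLog_eq_tsum (y : ℝ≥0∞) : negLog y = ∑' l : ℕ+, y ^ (l : ℕ) / ((l : ℕ) : ℝ≥0∞) := by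
  rw [tsum_pnat_eq_tsum_succPNat]
  simp only [Nat.succPNat_coe, Nat.succ_eq_add_one]
  rcases lt_or_ge y 1 with hy | hy
  · lift y to ℝ≥0 using hy.ne_top
    have hy1 : (y : ℝ) < 1 := by exact_mod_cast hy
    have h := Real.hasSum_pow_div_log_of_abs_lt_one (x := y) (by rwa [abs_of_nonneg y.coe_nonneg])
    have hlog : negLog y = ENNReal.ofReal (-Real.log (1 - y)) := by
      rw [negLog, ← ENNReal.ofReal_coe_nnreal, ← ENNReal.ofReal_one,
        ← ENNReal.ofReal_sub _ y.coe_nonneg, ENNReal.log_ofReal_of_pos (by linarith),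
        ← EReal.coe_neg, EReal.toENNReal_of_ne_top (EReal.coe_ne_top _), EReal.toReal_coe]
    rw [hlog, ← h.tsum_eq, ENNReal.ofReal_tsum_of_nonneg (fun q => by positivity) h.summable]
    refine tsum_congr fun q => ?_
    rw [ENNReal.ofReal_div_of_pos (by positivity), ENNReal.ofReal_pow y.coe_nonneg,
      ENNReal.ofReal_coe_nnreal, ← Nat.cast_succ, ENNReal.ofReal_natCast]
  · have h1 : negLog y = ⊤ := by
      rw [negLog, tsub_eq_zero_of_le hy]
      simp
    rw [h1]
    refine (top_le_iff.1 ?_).symm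
    have h2 : ∑' l : ℕ, ((((l + 1 : ℕ) : ℝ≥0)⁻¹ : ℝ≥0) : ℝ≥0∞) = ⊤ := by
      by_contra hne
      have hs := ENNReal.tsum_coe_ne_top_iff_summable.1 hne
      refine Real.not_summable_natCast_inv ((summable_nat_add_iff 1).1 ?_)
      simpa only [NNReal.coe_inv, NNReal.coe_natCast] using NNReal.summable_coe.2 hs
    rw [← h2]
    refine ENNReal.tsum_le_tsum fun l => ?_
    rw [ENNReal.coe_inv (by positivity), ENNReal.coe_natCast, ← one_div]
    exact ENNReal.div_le_div_right (one_le_pow₀ hy) _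

theorem negLog_eq_zero_iff {y : ℝ≥0∞} : negLog y = 0 ↔ y = 0 := by
  rw [negLog_eq_tsum, ENNReal.tsum_eq_zero]
  refine ⟨fun h => by simpa using h 1, fun h l => by simp [h]⟩

/-! ## The law of the number of batches of a multiset -/

/-- The partial sums of `∑ F j / j`. -/
def batchRate (F : ℕ+ → ℝ≥0∞) (J : ℕ) : ℝ≥0∞ :=
  ∑ j ∈ Finset.range J, F j.succPNat / ((j + 1 : ℕ) : ℝ≥0∞)

theorem iSup_batchRate (F : ℕ+ → ℝ≥0∞) :
    ⨆ J, batchRate F J = ∑' j : ℕ+, F j / ((j : ℕ) : ℝ≥0∞) := by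
  rw [tsum_pnat_eq_tsum_succPNat, ENNReal.tsum_eq_iSup_nat]
  rfl

theorem batchRate_add_tail (F : ℕ+ → ℝ≥0∞) (k : ℕ+) :
    batchRate F k + ∑' j : ℕ+, (if k < j then F j / ((j : ℕ) : ℝ≥0∞) else 0) =
      ∑' j : ℕ+, F j / ((j : ℕ) : ℝ≥0∞) := by
  have h : batchRate F k = ∑' j : ℕ+, if k < j then 0 else F j / ((j : ℕ) : ℝ≥0∞) := by
    rw [tsum_pnat_eq_tsum_succPNat, tsum_eq_sum (s := Finset.range k)]
    · refine Finset.sum_congr rfl fun j hj => ?_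
      rw [if_neg]
      · rfl
      · rw [not_lt, ← PNat.coe_le_coe, Nat.succPNat_coe]
        exact Finset.mem_range.1 hj
    · intro j hj
      rw [if_pos]
      rw [← PNat.coe_lt_coe, Nat.succPNat_coe]
      rw [Finset.mem_range] at hj
      omega
  rw [h, ← ENNReal.tsum_add]
  refine tsum_congr fun j => ?_
  split_ifs <;> simp

/-- The distribution function is the inverse exponential of the tail of the rate, so only the first
`k` terms remain. Finiteness is essential, since `⊤ * ⊤⁻¹ = 0`. -/
theorem expPos_mul_msetCdf {F : ℕ+ → ℝ≥0∞} (hF : ∑' j : ℕ+, F j / ((j : ℕ) : ℝ≥0∞) ≠ ⊤)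
    (k : ℕ+) : expPos (∑' j : ℕ+, F j / ((j : ℕ) : ℝ≥0∞)) * msetCdf F k =
      expPos (batchRate F k) := by
  rw [← batchRate_add_tail F k] at hF ⊢
  rw [msetCdf, expNeg_eq_inv, expPos_add, mul_assoc, ENNReal.mul_inv_cancel (expPos_ne_zero _),
    mul_one]
  rw [Ne, expPos_eq_top_iff]
  exact (ENNReal.add_ne_top.1 hF).2

theorem expPos_mul_msetLaw_one {F : ℕ+ → ℝ≥0∞}
    (hF : ∑' j : ℕ+, F j / ((j : ℕ) : ℝ≥0∞) ≠ ⊤) :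
    expPos (∑' j : ℕ+, F j / ((j : ℕ) : ℝ≥0∞)) * msetLaw F 1 = expPos (batchRate F 1) := by
  rw [msetLaw, if_pos rfl, expPos_mul_msetCdf hF]
  rfl

/-- Here `(m + 1).succPNat` is `m + 2`. The difference of consecutive values of the distribution
function contributes `exp l - 1`, which is the normalising constant of the Poisson law conditioned
to be positive. -/
theorem expPos_mul_msetLaw_mul_poissonPos {F : ℕ+ → ℝ≥0∞}
    (hF : ∑' j : ℕ+, F j / ((j : ℕ) : ℝ≥0∞) ≠ ⊤) (m q : ℕ) :
    expPos (∑' j : ℕ+, F j / ((j : ℕ) : ℝ≥0∞)) * msetLaw F (m + 1).succPNat *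
      poissonPos (F (m + 1).succPNat / ((m + 2 : ℕ) : ℝ≥0∞)) (q + 1) =
      expPos (batchRate F (m + 1)) * ((F (m + 1).succPNat / ((m + 2 : ℕ) : ℝ≥0∞)) ^ (q + 1) /
        ((q + 1).factorial : ℝ≥0∞)) := by
  set l := F (m + 1).succPNat / ((m + 2 : ℕ) : ℝ≥0∞) with hl
  have hne : (m + 1).succPNat ≠ 1 := fun h => by
    simpa using congrArg PNat.val h
  have hpred : (m + 1).succPNat - 1 = m.succPNat := by
    apply PNat.eq
    rw [PNat.sub_coe, if_pos (by rw [← PNat.coe_lt_coe]; simp)]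
    simp
  have htop : ∀ J, expPos (batchRate F J) ≠ ⊤ := fun J => by
    rw [Ne, expPos_eq_top_iff]
    exact ne_top_of_le_ne_top hF (iSup_batchRate F ▸ le_iSup (batchRate F) J)
  have hsucc : batchRate F (m + 2) = batchRate F (m + 1) + l := by
    rw [batchRate, Finset.sum_range_succ]
    rfl
  have hltop : l ≠ ⊤ := by
    have := htop (m + 2)
    rw [Ne, expPos_eq_top_iff, hsucc] at this
    exact (ENNReal.add_ne_top.1 this).2
  have h1 : expPos (∑' j : ℕ+, F j / ((j : ℕ) : ℝ≥0∞)) * msetLaw F (m + 1).succPNat =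
      expPos (batchRate F (m + 1)) * (expPos l - 1) := by
    rw [msetLaw, if_neg hne, hpred, ENNReal.mul_sub fun _ _ => by
      rwa [Ne, expPos_eq_top_iff], expPos_mul_msetCdf hF, expPos_mul_msetCdf hF,
      ENNReal.mul_sub fun _ _ => htop _, mul_one, ← expPos_add, ← hsucc]
    rfl
  rw [h1, poissonPos, if_neg q.succ_ne_zero, mul_assoc]
  -- For `l = 0` the constant `exp l - 1` is `0` and cannot be cancelled, but both sides vanish.
  rcases eq_or_ne l 0 with h0 | h0
  · simp [h0]
  congr 1
  rw [← mul_assoc, ENNReal.mul_inv_cancel, one_mul]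
  · rw [Ne, tsub_eq_zero_iff_le, not_le]
    exact lt_of_le_of_ne (one_le_expPos l) fun h => h0 (expPos_eq_one_iff.1 h.symm)
  · exact ENNReal.sub_ne_top (by rwa [Ne, expPos_eq_top_iff])

/-! ## The generating function counts colored members -/

theorem batchSum_const {M : Type*} (w : M → ℝ≥0∞) (j : ℕ) (c : ℝ≥0∞) :
    batchSum w j (fun _ => c) = expPos ((∑' m, w m ^ j) / (j : ℝ≥0∞)) * c := by
  simp only [batchSum, seqSum_const]
  rw [expPos_eq_tsum, ← ENNReal.tsum_mul_right]
  refine tsum_congr fun q => ?_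
  rw [div_eq_mul_inv (∑' m, w m ^ j), mul_pow, div_eq_mul_inv, div_eq_mul_inv]
  ring

theorem loopSum_const {M : Type*} (w : M → ℝ≥0∞) (J : ℕ) (c : ℝ≥0∞) :
    loopSum w J (fun _ => c) = expPos (batchRate (fun j => ∑' m, w m ^ (j : ℕ)) J) * c := by
  induction J generalizing c with
  | zero => simp [loopSum, batchRate, expPos_zero]
  | succ J ih =>
    simp only [loopSum, batchSum_const, ih]
    rw [batchRate, batchRate, Finset.sum_range_succ, expPos_add, mul_assoc]
    rfl

/-- The constant test function `1` in `iSup_loopSum`: the first `J` batches have total mass the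
exponential of the `J`-th partial sum. -/
theorem expPos_tsum_eq_tsum_multiset {M : Type*} (w : M → ℝ≥0∞) :
    expPos (∑' k : ℕ+, (∑' m, w m ^ (k : ℕ)) / ((k : ℕ) : ℝ≥0∞)) =
      ∑' S : Multiset M, (S.map w).prod := by
  have h := iSup_loopSum w fun _ => 1
  simp only [loopSum_const, mul_one, ← expPos_iSup, iSup_batchRate] at h
  exact h

/-- The weighted form of `tsum_cycle`: repeating a sequence `k` times raises its weight to the power
`k`. -/
theorem tsum_cycle_seqSum {M : Type*} (w : M → ℝ≥0∞) (ψ : Cycle M → ℝ≥0∞) :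
    ∑' k : ℕ+, ∑' l : ℕ+, (Nat.totient k : ℝ≥0∞) / (k : ℕ) * ((l : ℕ) : ℝ≥0∞)⁻¹ *
      seqSum (fun m => w m ^ (k : ℕ)) l (fun L => ψ ((List.replicate k L).flatten : List M)) =
      ∑' c : {c : Cycle M // c ≠ Cycle.nil}, (c.1.toMultiset.map w).prod * ψ c.1 := by
  rw [← tsum_cycle fun c => (c.toMultiset.map w).prod * ψ c]
  refine tsum_congr fun k => tsum_congr fun l => ?_
  rw [seqSum_eq_tsum]
  congr 1
  refine tsum_congr fun L => ?_
  simp only [Cycle.coe_toMultiset, Multiset.map_coe, Multiset.prod_coe, List.map_flatten,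
    List.map_replicate, List.prod_flatten, List.prod_replicate]
  have h : (L.map fun m => w m ^ (k : ℕ)).prod = (L.map w).prod ^ (k : ℕ) := by
    rw [← Multiset.prod_coe, ← Multiset.map_coe, Multiset.prod_map_pow]
    rfl
  rw [h]

theorem tsum_negLog_eq_tsum_cycle {M : Type*} (w : M → ℝ≥0∞) :
    ∑' k : ℕ+, (Nat.totient k : ℝ≥0∞) / (k : ℕ) * negLog (∑' m, w m ^ (k : ℕ)) =
      ∑' c : {c : Cycle M // c ≠ Cycle.nil}, (c.1.toMultiset.map w).prod := by
  have h := tsum_cycle_seqSum w fun _ => 1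
  simp only [seqSum_const, mul_one] at h
  rw [← h]
  refine tsum_congr fun k => ?_
  rw [negLog_eq_tsum, ← ENNReal.tsum_mul_left]
  refine tsum_congr fun l => ?_
  rw [div_eq_mul_inv _ ((l : ℕ) : ℝ≥0∞)]
  ring

/-- The family of substitutions `sᵢ = t xⁱ` is stable under dilation, so an induction that
quantifies over `x` covers the calls made with dilated parameters. -/
theorem dilate_colorParams (t : ℕ) (x : ℝ≥0) (k : ℕ+) :
    (colorParams t x).dilate k = colorParams t (x ^ (k : ℕ)) := by
  funext i
  simp [Params.dilate, colorParams, pow_mul]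

section GeneratingFunction

variable {ι : Type u} {spec : ι → ClassExpr ι} {t : ℕ}

/-- The depth `n` is arbitrary because the lemma serves twice: at finite `n` for the iterates of the
system, and at `⊤` for its least solution. -/
theorem gf_colorParams {F : ι → Params → ℝ≥0∞} {n : ℕ∞}
    (h : ∀ i (x : ℝ≥0), F i (colorParams t x) =
      ∑' m : Member spec (Fin t) (.name i), m.wt x n) (a : ClassExpr ι) (x : ℝ≥0) :
    a.gf F (colorParams t x) = ∑' m : Member spec (Fin t) a, m.wt x n := by
  have hpow : ∀ (x : ℝ≥0) (k : ℕ+) (a : ClassExpr ι), ∑' m : Member spec (Fin t) a,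
      m.wt ((x ^ (k : ℕ) : ℝ≥0) : ℝ≥0∞) n = ∑' m : Member spec (Fin t) a, m.wt x n ^ (k : ℕ) :=
    fun x k a => tsum_congr fun m => by rw [ENNReal.coe_pow, m.wt_pow _ k.ne_zero]
  induction a generalizing x with
  | neutral w => simpa [ClassExpr.gf] using (tsum_member_neutral (spec := spec) (B := Fin t)
      (x : ℝ≥0∞) n (fun _ => 1) w).symm
  | atom =>
    have := tsum_member_atom (spec := spec) (B := Fin t) (x : ℝ≥0∞) n fun _ => 1
    simp only [mul_one] at this
    simp [ClassExpr.gf, colorParams, this, mul_comm]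
  | name i => exact h i x
  | sum a b iha ihb =>
    have := tsum_member_sum (spec := spec) (a := a) (b := b) (B := Fin t) (x : ℝ≥0∞) n fun _ => 1
    simp only [mul_one] at this
    rw [ClassExpr.gf, this, iha, ihb]
  | prod a b iha ihb =>
    have := tsum_member_prod (spec := spec) (a := a) (b := b) (B := Fin t) (x : ℝ≥0∞) n fun _ => 1
    simp only [mul_one, ENNReal.tsum_mul_left, ENNReal.tsum_mul_right] at this
    rw [ClassExpr.gf, this, iha, ihb]
  | seq a ih =>
    have := tsum_member_seq (spec := spec) (a := a) (B := Fin t) (x : ℝ≥0∞) n fun _ => 1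
    simp only [mul_one] at this
    rw [ClassExpr.gf, this, ih, ← ENNReal.tsum_geometric]
    simpa [seqSum_const] using tsum_seqSum (fun m : Member spec (Fin t) a => m.wt x n) fun _ => 1
  | diag k a ih =>
    have := tsum_member_diag (spec := spec) (a := a) (B := Fin t) (x : ℝ≥0∞) n (fun _ => 1) k
    simp only [mul_one] at this
    rw [ClassExpr.gf, this, dilate_colorParams, ih, hpow]
  | mset a ih =>
    have := tsum_member_mset (spec := spec) (a := a) (B := Fin t) (x : ℝ≥0∞) n fun _ => 1
    simp only [mul_one] at this
    rw [ClassExpr.gf, this, ← expPos_tsum_eq_tsum_multiset]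
    congr 1
    refine tsum_congr fun k => ?_
    rw [dilate_colorParams, ih, hpow]
  | cyc a ih =>
    have := tsum_member_cyc (spec := spec) (a := a) (B := Fin t) (x : ℝ≥0∞) n fun _ => 1
    simp only [mul_one] at this
    rw [ClassExpr.gf, this, ← tsum_negLog_eq_tsum_cycle]
    refine tsum_congr fun k => ?_
    rw [dilate_colorParams, ih, hpow]

theorem tsum_wt_name (x : ℝ≥0∞) (n : ℕ∞) (i : ι) :
    ∑' m : Member spec (Fin t) (.name i), m.wt x n =
      if n = 0 then 0 else ∑' m : Member spec (Fin t) (spec i), m.wt x (n - 1) := by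
  simpa using tsum_member_name (spec := spec) (B := Fin t) x n (fun _ => 1) i

theorem gfIter_colorParams (n : ℕ) (i : ι) (x : ℝ≥0) :
    gfIter spec n i (colorParams t x) = ∑' m : Member spec (Fin t) (.name i), m.wt x n := by
  induction n generalizing i x with
  | zero => rw [tsum_wt_name, if_pos Nat.cast_zero]; rfl
  | succ n ih =>
    rw [tsum_wt_name, if_neg (by simp), enat_succ_sub_one]
    exact gf_colorParams ih (spec i) x

theorem genFun_colorParams (a : ClassExpr ι) (x : ℝ≥0) :
    genFun spec a (colorParams t x) = ∑' m : Member spec (Fin t) a, m.wt x ⊤ := by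
  refine gf_colorParams (fun i x => ?_) a x
  simp only [gfIter_colorParams]
  rw [← tsum_iSup_of_monotone fun m n h M => M.wt_mono x (Nat.cast_le.2 h)]
  exact tsum_congr fun M => M.iSup_wt x

/-- The fixed-point equation of the least solution, read off from the count of members, where `⊤ - 1
= ⊤`; continuity of the building rules is not needed. -/
theorem genFun_name_colorParams (i : ι) (x : ℝ≥0) :
    genFun spec (.name i) (colorParams t x) = genFun spec (spec i) (colorParams t x) := by
  rw [genFun_colorParams, genFun_colorParams, tsum_wt_name, if_neg ENat.top_ne_zero]
  rfl

/-- Settles the degenerate case in which the choice probabilities of a sampler would be quotients by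
`0`: both sides of the main identity are then `0`. -/
theorem wt_eq_zero_of_genFun_eq_zero {a : ClassExpr ι} {x : ℝ≥0}
    (h : genFun spec a (colorParams t x) = 0) (n : ℕ∞) (m : Member spec (Fin t) a) :
    m.wt x n = 0 := by
  rw [genFun_colorParams, ENNReal.tsum_eq_zero] at h
  exact le_antisymm ((m.wt_mono x le_top).trans (h m).le) zero_le

end GeneratingFunction

/-! ## Laws of concatenations -/

section Concat

variable {t : ℕ}

theorem expect_avg_swap {α : Type} (L : Law α) (G : List (Obj (Fin t)) → α → ℝ≥0∞)
    (S : ProfConcat) :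
    L.expect (fun a => S.avg fun l => G l a) = S.avg fun l => L.expect (G l) := by
  simp only [ProfConcat.avg, ← Law.expect_const_mul]
  simp only [Law.expect, Finset.mul_sum]
  exact Summable.tsum_finsetSum fun _ _ => ENNReal.summable

theorem ProfConcat.avg_const_mul (c : ℝ≥0∞) (ψ : List (Obj (Fin t)) → ℝ≥0∞) (S : ProfConcat) :
    S.avg (fun l => c * ψ l) = c * S.avg ψ := by
  simp only [ProfConcat.avg, Finset.mul_sum]
  exact Finset.sum_congr rfl fun _ _ => by ring

theorem expect_avg_const_mul (p : Law ProfConcat) (c : ℝ≥0∞) (ψ : List (Obj (Fin t)) → ℝ≥0∞) :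
    p.expect (ProfConcat.avg fun l => c * ψ l) = c * p.expect (ProfConcat.avg ψ) := by
  rw [← Law.expect_const_mul]
  congr 1
  funext S
  exact ProfConcat.avg_const_mul c ψ S

theorem expect_append (L : Law ProfConcat) (S : ProfConcat) (ψ : List (Obj (Fin t)) → ℝ≥0∞) :
    (L.bind fun A => Law.ret (S.append A)).expect (ProfConcat.avg ψ) =
      S.avg fun l => L.expect (ProfConcat.avg fun l' => ψ (l ++ l')) := by
  simp only [Law.expect_bind, Law.expect_ret, ProfConcat.avg_append]
  exact expect_avg_swap L _ S

theorem expect_appendBatch (N : Law ℕ) (p : Law ProfConcat) (S : ProfConcat)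
    (ψ : List (Obj (Fin t)) → ℝ≥0∞) :
    (appendBatch N p S).expect (ProfConcat.avg ψ) = S.avg fun l =>
      N.expect fun q => (concatDraws p q).expect (ProfConcat.avg fun l' => ψ (l ++ l')) := by
  rw [appendBatch, Law.expect_bind]
  simp only [expect_append]
  exact expect_avg_swap N _ S

theorem expect_enclose (q : Paren) (L : Law ProfConcat) (φ : Obj (Fin t) → ℝ≥0∞) :
    (L.bind fun S => Law.ret (S.enclose q)).expect (Profiled.avg φ) =
      L.expect (ProfConcat.avg fun l => φ (Obj.node q l)) := by
  simp only [Law.expect_bind, Law.expect_ret, ProfConcat.avg_enclose]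

theorem expect_diag (k : ℕ+) (L : Law Profiled) (ψ : List (Obj (Fin t)) → ℝ≥0∞) :
    (L.bind fun A => Law.ret (A.single.diag k)).expect (ProfConcat.avg ψ) =
      L.expect (Profiled.avg fun o => ψ (List.replicate k o)) := by
  simp only [Law.expect_bind, Law.expect_ret, ProfConcat.avg_diag, ProfConcat.avg_single,
    List.flatten_replicate_singleton]

theorem expect_single (L : Law Profiled) (ψ : List (Obj (Fin t)) → ℝ≥0∞) :
    (L.bind fun A => Law.ret A.single).expect (ProfConcat.avg ψ) =
      L.expect (Profiled.avg fun o => ψ [o]) := by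
  simp only [Law.expect_bind, Law.expect_ret, ProfConcat.avg_single]

/-- If `Z` times a law is a weighted sum over `M`, then `Z ^ q` times the law of `q` draws is the
weighted sum over sequences of length `q`. -/
theorem expect_concatDraws {M : Type*} {p : Law ProfConcat} {Z : ℝ≥0∞} {w : M → ℝ≥0∞}
    {g : M → List (Obj (Fin t))}
    (h : ∀ χ, Z * p.expect (ProfConcat.avg χ) = ∑' m, w m * χ (g m)) (q : ℕ)
    (ψ : List (Obj (Fin t)) → ℝ≥0∞) :
    Z ^ q * (concatDraws p q).expect (ProfConcat.avg ψ) =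
      seqSum w q fun l => ψ (l.map g).flatten := by
  induction q generalizing ψ with
  | zero => simp [concatDraws, Law.expect_ret, ProfConcat.avg_empty, seqSum]
  | succ q ih =>
    rw [concatDraws, Law.expect_bind, seqSum]
    simp only [expect_append]
    rw [pow_succ, mul_assoc, ← expect_avg_const_mul]
    simp only [h]
    rw [ih]
    simp only [List.map_append, List.flatten_append, List.map_cons, List.map_nil,
      List.flatten_cons, List.flatten_nil, List.append_nil]

theorem coe_flatten_map_replicate {M α : Type*} (f : M → α) (k : ℕ) (l : List M) :
    (((l.map fun m => List.replicate k (f m)).flatten : List α) : Multiset α) =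
      (k • (l : Multiset M)).map f := by
  induction l with
  | nil => simp
  | cons m l ih =>
    rw [List.map_cons, List.flatten_cons, ← Multiset.coe_add, ih, ← Multiset.cons_coe,
      ← Multiset.singleton_add, smul_add, Multiset.map_add, Multiset.nsmul_singleton,
      Multiset.map_replicate, Multiset.coe_replicate]

/-! ### Poisson batches and the law of `K` -/

section Batches

variable {M : Type*} {w : M → ℝ≥0∞} {f : M → Obj (Fin t)}

theorem pow_div_mul_expect_concatDraws {p : Law ProfConcat} {Z : ℝ≥0∞} {j : ℕ}
    (h : ∀ χ : List (Obj (Fin t)) → ℝ≥0∞, Z * p.expect (ProfConcat.avg χ) =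
      ∑' m, w m ^ j * χ (List.replicate j (f m))) (q : ℕ)
    (Φ : Multiset (Obj (Fin t)) → ℝ≥0∞) :
    (Z / (j : ℝ≥0∞)) ^ q / (q.factorial : ℝ≥0∞) *
      (concatDraws p q).expect (ProfConcat.avg fun l : List (Obj (Fin t)) => Φ l) =
      (j : ℝ≥0∞)⁻¹ ^ q / (q.factorial : ℝ≥0∞) *
        seqSum (fun m => w m ^ j) q fun l => Φ ((j • (l : Multiset M)).map f) := by
  have := expect_concatDraws (g := fun m => List.replicate j (f m)) h q fun l => Φ l
  simp only [coe_flatten_map_replicate] at this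
  rw [← this, div_eq_mul_inv Z, mul_pow, div_eq_mul_inv, div_eq_mul_inv]
  ring

theorem expPos_mul_expect_poisson {p : Law ProfConcat} {Z : ℝ≥0∞} {j : ℕ}
    (hZ : Z / (j : ℝ≥0∞) ≠ ⊤)
    (h : ∀ χ : List (Obj (Fin t)) → ℝ≥0∞, Z * p.expect (ProfConcat.avg χ) =
      ∑' m, w m ^ j * χ (List.replicate j (f m)))
    (Φ : Multiset (Obj (Fin t)) → ℝ≥0∞) :
    expPos (Z / (j : ℝ≥0∞)) * (poisson (Z / (j : ℝ≥0∞))).expect (fun q =>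
      (concatDraws p q).expect (ProfConcat.avg fun l : List (Obj (Fin t)) => Φ l)) =
      batchSum w j fun T => Φ (T.map f) := by
  rw [Law.expect, ← ENNReal.tsum_mul_left, batchSum]
  refine tsum_congr fun q => ?_
  rw [← pow_div_mul_expect_concatDraws h, poisson, ← mul_assoc, ← mul_assoc, expNeg_eq_inv,
    ENNReal.mul_inv_cancel (expPos_ne_zero _) (by rwa [Ne, expPos_eq_top_iff]), one_mul]

theorem expPos_mul_expect_msetLoop {p : ℕ+ → Law ProfConcat} {F : ℕ+ → ℝ≥0∞}
    (hF : ∀ j : ℕ+, F j / ((j : ℕ) : ℝ≥0∞) ≠ ⊤)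
    (h : ∀ (j : ℕ+) (χ : List (Obj (Fin t)) → ℝ≥0∞), F j * (p j).expect (ProfConcat.avg χ) =
      ∑' m, w m ^ (j : ℕ) * χ (List.replicate j (f m))) (J : ℕ)
    (Φ : Multiset (Obj (Fin t)) → ℝ≥0∞) :
    expPos (batchRate F J) * (msetLoop F p J).expect (ProfConcat.avg fun l : List (Obj (Fin t)) => Φ l) =
      loopSum w J fun S => Φ (S.map f) := by
  induction J generalizing Φ with
  | zero => simp [batchRate, expPos_zero, msetLoop, Law.expect_ret, ProfConcat.avg_empty, loopSum]
  | succ J ih =>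
    rw [msetLoop, Law.expect_bind, loopSum]
    simp only [expect_appendBatch]
    rw [batchRate, Finset.sum_range_succ, expPos_add, mul_assoc, ← batchRate]
    rw [← expect_avg_const_mul]
    simp only [← Multiset.coe_add]
    have h1 := fun l : List (Obj (Fin t)) =>
      expPos_mul_expect_poisson (hF J.succPNat) (h J.succPNat) fun l' => Φ (l + l')
    simp only [Nat.succPNat_coe, Nat.succ_eq_add_one] at h1
    simp only [h1]
    rw [ih fun S => batchSum w (J + 1) fun T => Φ (S + T.map f)]
    simp only [Multiset.map_add]

/-- Telescoping, with the increments given additively so that no subtraction in `[0, ∞]` occurs. -/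
theorem add_tsum_eq_iSup {c d : ℕ → ℝ≥0∞} (h : ∀ m, c (m + 1) = c m + d m) :
    c 0 + ∑' m, d m = ⨆ m, c m := by
  have h1 : ∀ m, c m = c 0 + ∑ i ∈ Finset.range m, d i := fun m => by
    induction m with
    | zero => simp
    | succ m ih => rw [h, ih, Finset.sum_range_succ, add_assoc]
  rw [ENNReal.tsum_eq_iSup_nat, ENNReal.add_iSup]
  exact iSup_congr fun m => (h1 m).symm

theorem expPos_mul_msetLaw_mul_expect_poissonPos {p : Law ProfConcat} {F : ℕ+ → ℝ≥0∞} {m : ℕ}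
    (hF : ∑' j : ℕ+, F j / ((j : ℕ) : ℝ≥0∞) ≠ ⊤)
    (h : ∀ χ : List (Obj (Fin t)) → ℝ≥0∞, F (m + 1).succPNat * p.expect (ProfConcat.avg χ) =
      ∑' x, w x ^ (m + 2) * χ (List.replicate (m + 2) (f x)))
    (Φ : Multiset (Obj (Fin t)) → ℝ≥0∞) :
    expPos (∑' j : ℕ+, F j / ((j : ℕ) : ℝ≥0∞)) * msetLaw F (m + 1).succPNat *
      (poissonPos (F (m + 1).succPNat / ((m + 2 : ℕ) : ℝ≥0∞))).expect (fun q =>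
        (concatDraws p q).expect (ProfConcat.avg fun l : List (Obj (Fin t)) => Φ l)) =
      expPos (batchRate F (m + 1)) * ∑' q : ℕ,
        ((m + 2 : ℕ) : ℝ≥0∞)⁻¹ ^ (q + 1) / ((q + 1).factorial : ℝ≥0∞) *
          seqSum (fun x => w x ^ (m + 2)) (q + 1) fun L =>
            Φ (((m + 2) • (L : Multiset M)).map f) := by
  rw [Law.expect, tsum_eq_zero_add' ENNReal.summable, poissonPos, if_pos rfl, zero_mul, zero_add,
    ← ENNReal.tsum_mul_left, ← ENNReal.tsum_mul_left]
  refine tsum_congr fun q => ?_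
  rw [← mul_assoc, expPos_mul_msetLaw_mul_poissonPos hF, mul_assoc,
    pow_div_mul_expect_concatDraws h]

/-- `K = 1` accounts for the unions using batch `1` alone, and `K = m + 2` for those whose last
nonempty batch is number `m + 2`. The latter is the increment from `loopSum w (m + 1)` to `loopSum w
(m + 2)`, so summing over `K` gives the supremum of the loop sums. -/
theorem expPos_mul_expect_mset {p : ℕ+ → Law ProfConcat} {F : ℕ+ → ℝ≥0∞}
    (hF : ∑' j : ℕ+, F j / ((j : ℕ) : ℝ≥0∞) ≠ ⊤)
    (h : ∀ (j : ℕ+) (χ : List (Obj (Fin t)) → ℝ≥0∞), F j * (p j).expect (ProfConcat.avg χ) =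
      ∑' m, w m ^ (j : ℕ) * χ (List.replicate j (f m)))
    (Φ : Multiset (Obj (Fin t)) → ℝ≥0∞) :
    expPos (∑' j : ℕ+, F j / ((j : ℕ) : ℝ≥0∞)) * (msetLaw F).expect (fun k =>
      (if k = 1 then msetLoop F p 1
          else (msetLoop F p k.natPred).bind
            (appendBatch (poissonPos (F k / (k : ℕ))) (p k))).expect
              (ProfConcat.avg fun l : List (Obj (Fin t)) => Φ l)) =
      ∑' S : Multiset M, (S.map w).prod * Φ (S.map f) := by
  have hF' : ∀ j : ℕ+, F j / ((j : ℕ) : ℝ≥0∞) ≠ ⊤ := ENNReal.ne_top_of_tsum_ne_top hF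
  rw [← iSup_loopSum w fun S => Φ (S.map f), ← (loopSum_monotone w _).iSup_nat_add 1]
  rw [Law.expect, ← ENNReal.tsum_mul_left, tsum_pnat_eq_tsum_succPNat,
    tsum_eq_zero_add' ENNReal.summable]
  have h1 : (0 : ℕ).succPNat = 1 := rfl
  rw [h1, if_pos rfl, ← mul_assoc, expPos_mul_msetLaw_one hF,
    expPos_mul_expect_msetLoop hF' h]
  refine add_tsum_eq_iSup (c := fun m => loopSum w (m + 1) fun S => Φ (S.map f)) fun m => ?_
  have hne : (m + 1).succPNat ≠ 1 := fun h => by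
    simpa using congrArg PNat.val h
  rw [if_neg hne, Law.expect_bind]
  simp only [expect_appendBatch]
  rw [← mul_assoc, ← expect_avg_const_mul]
  have h2 := fun l : List (Obj (Fin t)) =>
    expPos_mul_msetLaw_mul_expect_poissonPos hF (h (m + 1).succPNat) fun l' => Φ (l + l')
  simp only [Multiset.coe_add] at h2
  have hcoe : (((m + 1).succPNat : ℕ) : ℝ≥0∞) = ((m + 2 : ℕ) : ℝ≥0∞) := rfl
  simp only [hcoe, h2, Nat.natPred_succPNat]
  rw [expect_avg_const_mul, expPos_mul_expect_msetLoop hF' h (m + 1) fun S =>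
    ∑' q : ℕ, ((m + 2 : ℕ) : ℝ≥0∞)⁻¹ ^ (q + 1) / ((q + 1).factorial : ℝ≥0∞) *
      seqSum (fun x => w x ^ (m + 2)) (q + 1) fun L => Φ (S + ((m + 2) • (L : Multiset M)).map f),
    ← loopSum_add, loopSum]
  simp only [batchSum_eq_zero_add, add_zero, Multiset.map_add, Multiset.map_zero]

end Batches

end Concat

/-! ## The law of the colored samplers -/

theorem mul_cycLaw_mul_logLaw {F : ℕ+ → ℝ≥0∞} {G : ℝ≥0∞}
    (hG : G = ∑' j : ℕ+, (Nat.totient j : ℝ≥0∞) / (j : ℕ) * negLog (F j)) (h0 : G ≠ 0)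
    (htop : G ≠ ⊤) (k l : ℕ+) :
    G * cycLaw F k * logLaw (F k) l =
      (Nat.totient k : ℝ≥0∞) / (k : ℕ) * ((l : ℕ) : ℝ≥0∞)⁻¹ * F k ^ (l : ℕ) := by
  have h1 : G * cycLaw F k = (Nat.totient k : ℝ≥0∞) / (k : ℕ) * negLog (F k) := by
    rw [cycLaw, ← hG, ENNReal.mul_div_cancel h0 htop]
  rw [h1, logLaw]
  -- Here `negLog (F k)` is `0` and does not cancel; both sides are `0` because `l ≥ 1`.
  rcases eq_or_ne (F k) 0 with hF | hF
  · simp [hF]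
  have hlog : negLog (F k) ≠ ⊤ := fun h => by
    have := ENNReal.ne_top_of_tsum_ne_top (hG ▸ htop) k
    rw [h, ENNReal.mul_top] at this
    · exact this rfl
    · simp
  rw [mul_assoc, ENNReal.mul_div_cancel (fun h => hF (negLog_eq_zero_iff.1 h)) hlog,
    div_eq_mul_inv (F k ^ (l : ℕ))]
  ring

theorem flatten_map_singleton {α β : Type*} (f : α → β) (l : List α) :
    (l.map fun a => [f a]).flatten = l.map f := by
  induction l with
  | nil => rfl
  | cons a l ih => simp [ih]

section Sampler

variable {ι : Type u} {spec : ι → ClassExpr ι} {t : ℕ}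

theorem ne_top_of_tsum_negLog {F : ℕ+ → ℝ≥0∞}
    (h : ∑' j : ℕ+, (Nat.totient j : ℝ≥0∞) / (j : ℕ) * negLog (F j) ≠ ⊤) (k : ℕ+) : F k ≠ ⊤ := by
  intro hk
  refine ENNReal.ne_top_of_tsum_ne_top h k ?_
  have : negLog ⊤ = ⊤ := by simp [negLog]
  rw [hk, this, ENNReal.mul_top]
  simp

/-- The inductive step of the main identity, for any meaning `R` of the named calls that satisfies
it at depth `n`. Only the weights depend on `n`: the choice probabilities use the full generating
functions, so these are the normalising constants at every depth. -/
theorem genFun_mul_expect_sample {R : ι → Params → Law Profiled} {n : ℕ∞} (ht : t ≠ 0)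
    (hR : ∀ i (x : ℝ≥0) (φ : Obj (Fin t) → ℝ≥0∞),
      genFun spec (.name i) (colorParams t x) ≠ ⊤ →
      genFun spec (.name i) (colorParams t x) * (R i (colorParams t x)).expect (Profiled.avg φ) =
        ∑' m : Member spec (Fin t) (.name i), m.wt x n * φ m.obj)
    (a : ClassExpr ι) (x : ℝ≥0) (φ : Obj (Fin t) → ℝ≥0∞)
    (htop : genFun spec a (colorParams t x) ≠ ⊤) :
    genFun spec a (colorParams t x) *
      (a.sample spec R (colorParams t x)).expect (Profiled.avg φ) =
        ∑' m : Member spec (Fin t) a, m.wt x n * φ m.obj := by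
  induction a generalizing x φ with
  | neutral w =>
    rw [tsum_member_neutral, ClassExpr.sample, Law.expect_ret, Profiled.avg_neutral]
    exact one_mul _
  | atom =>
    rw [tsum_member_atom, ClassExpr.sample, Law.expect_ret, Profiled.avg_atom, ← mul_assoc]
    have h : genFun spec .atom (colorParams t x) = x * t := by
      simp [genFun, ClassExpr.gf, colorParams, mul_comm]
    -- The factor `t` of `s₁ = t x` cancels the probability `1 / t` of each color.
    rw [h, mul_assoc (x : ℝ≥0∞), ENNReal.mul_inv_cancel (by simpa using ht)
      (ENNReal.natCast_ne_top t), mul_one]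
  | name i => exact hR i x φ htop
  | sum a b iha ihb =>
    rcases eq_or_ne (genFun spec (.sum a b) (colorParams t x)) 0 with h0 | h0
    · simp [h0, wt_eq_zero_of_genFun_eq_zero h0]
    have hadd : genFun spec (.sum a b) (colorParams t x) =
      genFun spec a (colorParams t x) + genFun spec b (colorParams t x) := rfl
    have hab := ENNReal.add_ne_top.1 (hadd ▸ htop)
    have h1 : genFun spec (.sum a b) (colorParams t x) *
        (1 - genFun spec a (colorParams t x) / genFun spec (.sum a b) (colorParams t x)) =
          genFun spec b (colorParams t x) := by
      rw [ENNReal.mul_sub fun _ _ => htop, mul_one, ENNReal.mul_div_cancel h0 htop, hadd,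
        ENNReal.add_sub_cancel_left hab.1]
    rw [tsum_member_sum, ← iha x φ hab.1, ← ihb x φ hab.2, ClassExpr.sample, Law.expect_bind,
      Law.expect, tsum_bool, mul_add, ← mul_assoc, ← mul_assoc]
    simp only [bern, if_true, if_false, Bool.false_eq_true, h1]
    rw [ENNReal.mul_div_cancel h0 htop, add_comm]
  | prod a b iha ihb =>
    rcases eq_or_ne (genFun spec (.prod a b) (colorParams t x)) 0 with h0 | h0
    · simp [h0, wt_eq_zero_of_genFun_eq_zero h0]
    have hmul : genFun spec (.prod a b) (colorParams t x) =
      genFun spec a (colorParams t x) * genFun spec b (colorParams t x) := rfl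
    rw [hmul] at h0 htop ⊢
    -- A finite nonzero product has finite factors; with a zero factor the other could be infinite,
    -- which is why that case was removed first.
    have ha : genFun spec a (colorParams t x) ≠ ⊤ := fun h => by
      rw [h, ENNReal.top_mul (right_ne_zero_of_mul h0)] at htop
      exact htop rfl
    have hb : genFun spec b (colorParams t x) ≠ ⊤ := fun h => by
      rw [h, ENNReal.mul_top (left_ne_zero_of_mul h0)] at htop
      exact htop rfl
    rw [tsum_member_prod, ClassExpr.sample, Law.expect_bind]
    simp only [Law.expect_bind, Law.expect_ret, ProfConcat.avg_enclose, ProfConcat.avg_append,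
      expect_avg_swap]
    simp only [ProfConcat.avg_single, List.singleton_append]
    rw [mul_comm (genFun spec a _), mul_assoc, iha x (fun o => (b.sample spec R _).expect
      fun B => B.avg fun o' => φ (Obj.node .seq [o, o'])) ha, ← ENNReal.tsum_mul_left]
    refine tsum_congr fun m => ?_
    rw [ENNReal.tsum_mul_left, mul_left_comm]
    congr 1
    exact ihb x (fun o' => φ (Obj.node .seq [m.obj, o'])) hb
  | seq a ih =>
    rcases eq_or_ne (genFun spec (.seq a) (colorParams t x)) 0 with h0 | h0
    · simp [h0, wt_eq_zero_of_genFun_eq_zero h0]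
    have hinv : genFun spec (.seq a) (colorParams t x) =
      (1 - genFun spec a (colorParams t x))⁻¹ := rfl
    have ha : genFun spec a (colorParams t x) ≠ ⊤ := fun h => by
      rw [hinv, h] at htop
      simp at htop
    have h1 : ∀ k, genFun spec (.seq a) (colorParams t x) *
        geom (genFun spec a (colorParams t x)) k = genFun spec a (colorParams t x) ^ k := fun k => by
      -- Finiteness of `(1 - F)⁻¹` forces `1 - F ≠ 0`, so the factor `1 - F` of the geometric law
      -- cancels.
      rw [geom, mul_left_comm, hinv, ENNReal.inv_mul_cancel, mul_one]
      · exact fun h => htop (by rw [hinv, h, ENNReal.inv_zero])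
      · exact ENNReal.sub_ne_top ENNReal.one_ne_top
    have h2 := expect_concatDraws (g := fun m : Member spec (Fin t) a => [m.obj])
      (w := fun m => m.wt x n)
      (p := (a.sample spec R (colorParams t x)).bind fun A => Law.ret A.single)
      (Z := genFun spec a (colorParams t x)) fun χ => by
        rw [expect_single, ih x _ ha]
    rw [tsum_member_seq, ← tsum_seqSum, ClassExpr.sample, Law.expect_bind, Law.expect,
      ← ENNReal.tsum_mul_left]
    refine tsum_congr fun k => ?_
    rw [← mul_assoc, h1, expect_enclose, h2]
    simp only [flatten_map_singleton]
  | diag k a ih =>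
    have hdil : genFun spec (.diag k a) (colorParams t x) =
      genFun spec a (colorParams t (x ^ (k : ℕ))) := by rw [← dilate_colorParams]; rfl
    rw [hdil] at htop ⊢
    rw [tsum_member_diag, ClassExpr.sample, Law.expect_bind, dilate_colorParams]
    simp only [Law.expect_ret, ProfConcat.avg_enclose, ProfConcat.avg_diag, ProfConcat.avg_single,
      List.flatten_replicate_singleton]
    rw [ih _ (fun o => φ (Obj.node .seq (List.replicate k o))) htop]
    exact tsum_congr fun m => by rw [ENNReal.coe_pow, m.wt_pow _ k.ne_zero]
  | mset a ih =>
    have hexp : genFun spec (.mset a) (colorParams t x) = expPos (∑' k : ℕ+,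
      genFun spec a ((colorParams t x).dilate k) / ((k : ℕ) : ℝ≥0∞)) := rfl
    rw [hexp] at htop ⊢
    -- An exponential is never `0`, so no degenerate case arises for multisets.
    rw [Ne, expPos_eq_top_iff] at htop
    rw [tsum_member_mset]
    have h := expPos_mul_expect_mset (w := fun m : Member spec (Fin t) a => m.wt x n)
      (f := Member.obj) (F := fun j => genFun spec a ((colorParams t x).dilate j))
      (p := fun j => (a.sample spec R ((colorParams t x).dilate j)).bind fun A =>
        Law.ret (A.single.diag j)) htop (fun j χ => by
          rw [expect_diag, dilate_colorParams, ih]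
          · exact tsum_congr fun m => by rw [ENNReal.coe_pow, m.wt_pow _ j.ne_zero]
          · rw [← dilate_colorParams]
            intro hj
            refine ENNReal.ne_top_of_tsum_ne_top htop j ?_
            rw [hj]
            exact ENNReal.top_div_of_ne_top (ENNReal.natCast_ne_top _)) fun S => φ (Obj.mset S)
    rw [← h, ClassExpr.sample, Law.expect_bind]
    simp only [expect_enclose]
    rfl
  | cyc a ih =>
    rcases eq_or_ne (genFun spec (.cyc a) (colorParams t x)) 0 with h0 | h0
    · simp [h0, wt_eq_zero_of_genFun_eq_zero h0]
    have hsum : genFun spec (.cyc a) (colorParams t x) = ∑' k : ℕ+, (Nat.totient k : ℝ≥0∞) /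
      (k : ℕ) * negLog (genFun spec a ((colorParams t x).dilate k)) := rfl
    rw [tsum_member_cyc, ← tsum_cycle_seqSum (fun m : Member spec (Fin t) a => m.wt x n)
      fun c => φ (Obj.cyc (c.map Member.obj))]
    rw [ClassExpr.sample, Law.expect_bind, Law.expect, ← ENNReal.tsum_mul_left]
    refine tsum_congr fun k => ?_
    rw [Law.expect_bind, Law.expect, ← ENNReal.tsum_mul_left, ← ENNReal.tsum_mul_left]
    refine tsum_congr fun l => ?_
    have hk := ne_top_of_tsum_negLog (hsum ▸ htop) k
    have h2 := expect_concatDraws (g := fun m : Member spec (Fin t) a => [m.obj])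
      (w := fun m => m.wt x n ^ (k : ℕ))
      (p := (a.sample spec R ((colorParams t x).dilate k)).bind fun A => Law.ret A.single)
      (Z := genFun spec a ((colorParams t x).dilate k)) fun χ => by
        rw [dilate_colorParams] at hk ⊢
        rw [expect_single, ih _ _ hk]
        exact tsum_congr fun m => by rw [ENNReal.coe_pow, m.wt_pow _ k.ne_zero]
    rw [← mul_assoc, ← mul_assoc, mul_cycLaw_mul_logLaw hsum h0 htop, mul_assoc, Law.expect_bind]
    simp only [Law.expect_ret, ProfConcat.avg_enclose, ProfConcat.avg_diag]
    rw [h2]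
    congr 2
    funext L
    rw [flatten_map_singleton, Cycle.map_coe, List.map_flatten, List.map_replicate]
    rfl

/-! ## Recursive calls -/

theorem concatDraws_mono {p p' : Law ProfConcat} (h : p ≤ p') (q : ℕ) :
    concatDraws p q ≤ concatDraws p' q := by
  induction q with
  | zero => exact le_rfl
  | succ q ih => exact Law.bind_mono ih fun _ => Law.bind_mono h fun _ => le_rfl

theorem appendBatch_mono (N : Law ℕ) {p p' : Law ProfConcat} (h : p ≤ p') (S : ProfConcat) :
    appendBatch N p S ≤ appendBatch N p' S :=
  Law.bind_mono le_rfl fun q => Law.bind_mono (concatDraws_mono h q) fun _ => le_rfl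

theorem msetLoop_mono (F : ℕ+ → ℝ≥0∞) {p p' : ℕ+ → Law ProfConcat} (h : ∀ j, p j ≤ p' j)
    (J : ℕ) : msetLoop F p J ≤ msetLoop F p' J := by
  induction J with
  | zero => exact le_rfl
  | succ J ih => exact Law.bind_mono ih (appendBatch_mono _ (h _))

/-- The recursive calls enter only through `R`, and the laws of the choices do not depend on `R`;
hence the bounded samplers increase with the bound. -/
theorem sample_mono {R R' : ι → Params → Law Profiled} (h : R ≤ R') (a : ClassExpr ι)
    (s : Params) : a.sample spec R s ≤ a.sample spec R' s := by
  induction a generalizing s with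
  | neutral w => exact le_rfl
  | atom => exact le_rfl
  | name i => exact h i s
  | sum a b iha ihb =>
    refine Law.bind_mono le_rfl fun X => ?_
    cases X
    · exact ihb s
    · exact iha s
  | prod a b iha ihb =>
    exact Law.bind_mono (iha s) fun _ => Law.bind_mono (ihb s) fun _ => le_rfl
  | seq a ih =>
    exact Law.bind_mono le_rfl fun k => Law.bind_mono
      (concatDraws_mono (Law.bind_mono (ih s) fun _ => le_rfl) k) fun _ => le_rfl
  | diag k a ih => exact Law.bind_mono (ih _) fun _ => le_rfl
  | mset a ih =>
    have hp : ∀ j : ℕ+, ((a.sample spec R (s.dilate j)).bind fun A => Law.ret (A.single.diag j)) ≤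
        (a.sample spec R' (s.dilate j)).bind fun A => Law.ret (A.single.diag j) := fun j =>
      Law.bind_mono (ih _) fun _ => le_rfl
    refine Law.bind_mono le_rfl fun k => Law.bind_mono ?_ fun _ => le_rfl
    split_ifs
    · exact msetLoop_mono _ hp 1
    · exact Law.bind_mono (msetLoop_mono _ hp _) (appendBatch_mono _ (hp k))
  | cyc a ih =>
    exact Law.bind_mono le_rfl fun k => Law.bind_mono le_rfl fun l => Law.bind_mono
      (concatDraws_mono (Law.bind_mono (ih _) fun _ => le_rfl) l) fun _ => le_rfl

theorem sampleIter_monotone : Monotone (sampleIter spec) := by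
  refine monotone_nat_of_le_succ fun n => ?_
  induction n with
  | zero => exact fun _ _ _ => zero_le
  | succ n ih => exact fun i s => sample_mono ih (spec i) s

/-- Unfolding a name uses one level of nesting on both sides, while the fixed-point equation leaves
the normalising constant unchanged. -/
theorem genFun_mul_expect_sampleIter (ht : t ≠ 0) (n : ℕ) (i : ι) (x : ℝ≥0)
    (φ : Obj (Fin t) → ℝ≥0∞) (htop : genFun spec (.name i) (colorParams t x) ≠ ⊤) :
    genFun spec (.name i) (colorParams t x) *
      (sampleIter spec n i (colorParams t x)).expect (Profiled.avg φ) =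
        ∑' m : Member spec (Fin t) (.name i), m.wt x n * φ m.obj := by
  induction n generalizing i x φ with
  | zero =>
    rw [tsum_member_name, if_pos Nat.cast_zero]
    simp [sampleIter, Law.expect]
  | succ n ih =>
    rw [genFun_name_colorParams] at htop ⊢
    rw [tsum_member_name, if_neg (by simp), enat_succ_sub_one]
    exact genFun_mul_expect_sample ht ih (spec i) x φ htop

/-- Monotone convergence on both sides: the bounded samplers increase to the sampler, and the
truncated weights to `x ^ |m|`. -/
theorem genFun_mul_expect_profiledSampler (ht : t ≠ 0) (a : ClassExpr ι) (x : ℝ≥0)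
    (φ : Obj (Fin t) → ℝ≥0∞) (htop : genFun spec a (colorParams t x) ≠ ⊤) :
    genFun spec a (colorParams t x) *
      (profiledSampler spec a (colorParams t x)).expect (Profiled.avg φ) =
        ∑' m : Member spec (Fin t) a, (x : ℝ≥0∞) ^ m.obj.size * φ m.obj := by
  unfold profiledSampler
  rw [Law.expect_iSup fun m n h => sample_mono (sampleIter_monotone h) a _, ENNReal.mul_iSup]
  simp only [genFun_mul_expect_sample ht
    (fun i x φ => genFun_mul_expect_sampleIter ht _ i x φ) a x φ htop]
  rw [← tsum_iSup_of_monotone (f := fun n (m : Member spec (Fin t) a) =>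
    m.wt x (n : ℕ) * φ m.obj) fun m n h M => mul_le_mul_left (M.wt_mono x (Nat.cast_le.2 h)) _]
  exact tsum_congr fun M => by rw [← ENNReal.iSup_mul, M.iSup_wt, M.wt_top]

theorem expect_coloredSampler (a : ClassExpr ι) (x : ℝ≥0) (φ : Obj (Fin t) → ℝ≥0∞) :
    (coloredSampler spec a t x).expect φ =
      (profiledSampler spec a (colorParams t x)).expect (Profiled.avg φ) := by
  simp only [coloredSampler, Law.expect_bind, Law.expect_ret]
  congr 1
  funext P
  simp [Law.expect, tsum_fintype, uniformColors, Profiled.avg]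

theorem Law.expect_indicator {α : Type} [DecidableEq α] (L : Law α) (a : α) :
    L.expect (fun b => if b = a then 1 else 0) = L a := by
  simp [Law.expect]

end Sampler

end
end ColoredBoltzmann

/-! ### The Boltzmann property -/

theorem proposition4p1 {ι : Type*} (spec : ι → ColoredBoltzmann.ClassExpr ι)
    (A : ColoredBoltzmann.ClassExpr ι) (t : ℕ) (ht : 1 ≤ t) (x : ℝ≥0) (f : ℝ≥0∞)
    (hf : f = ColoredBoltzmann.genFun spec A (ColoredBoltzmann.colorParams t x))
    (hf0 : f ≠ 0) (hf_top : f ≠ ⊤) :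
    (∑' o, ColoredBoltzmann.coloredSampler spec A t x o = 1) ∧
      ∀ o : ColoredBoltzmann.Obj (Fin t),
        ColoredBoltzmann.coloredSampler spec A t x o =
          (ColoredBoltzmann.mult spec A o : ℝ≥0∞) * ((x : ℝ≥0∞) ^ o.size / f) := by
  classical
  have key : ∀ φ : ColoredBoltzmann.Obj (Fin t) → ℝ≥0∞,
      f * (ColoredBoltzmann.coloredSampler spec A t x).expect φ =
        ∑' m : ColoredBoltzmann.Member spec (Fin t) A, (x : ℝ≥0∞) ^ m.obj.size * φ m.obj :=
    fun φ => by
      rw [ColoredBoltzmann.expect_coloredSampler, hf,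
        ColoredBoltzmann.genFun_mul_expect_profiledSampler (by omega) A x φ (hf ▸ hf_top)]
  constructor
  -- For the constant `1` the right side is `f` itself, which is finite and nonzero and can be
  -- cancelled.
  · have h := key fun _ => 1
    simp only [ColoredBoltzmann.Law.expect, mul_one, ← ColoredBoltzmann.Member.wt_top] at h
    rw [← ColoredBoltzmann.genFun_colorParams, ← hf] at h
    exact (ENNReal.mul_eq_left hf0 hf_top).1 h
  · intro o
    have h := key fun o' => if o' = o then 1 else 0
    rw [ColoredBoltzmann.Law.expect_indicator] at h
    have h1 : ∑' m : ColoredBoltzmann.Member spec (Fin t) A,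
        (x : ℝ≥0∞) ^ m.obj.size * (if m.obj = o then 1 else 0) =
          (ColoredBoltzmann.mult spec A o : ℝ≥0∞) * (x : ℝ≥0∞) ^ o.size := by
      -- The multiplicity, possibly infinite, is written as a sum of ones over the members lying
      -- above `o`.
      rw [ColoredBoltzmann.mult, ← ENNReal.tsum_set_one, ← ENNReal.tsum_mul_right,
        tsum_subtype {m : ColoredBoltzmann.Member spec (Fin t) A | m.obj = o}
          fun _ => 1 * (x : ℝ≥0∞) ^ o.size]
      refine tsum_congr fun m => ?_
      by_cases hm : m.obj = o <;> simp [Set.indicator, hm]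
    rw [h1] at h
    rw [← mul_div_assoc, ENNReal.eq_div_iff hf0 hf_top, h]
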